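/- Fix constants $\sigma,B,C_1,C_2,C_3,C_4,c>0$. Then there is a constant $M>0$, depending only on these, such that the following holds for all integers $n\ge 2$ and $1\le k^*\le n$. Model. The observation is $X\sim P_\theta^{(n)}=N(\theta,\sigma^2I_n)$ with $\theta\in\mathbb R^n$. Let $\Theta_k$ be the set of $\theta\in\mathbb R^n$ for which there are integers $0=a_0\le a_1\le\dots\le a_k=n$ and reals $\mu_1,\dots,\mu_k$ with $\theta_i=\mu_j$ whenever $a_{j-1}<i\le a_j$, and let $\Theta_k(B)=\{\theta\in\Theta_k:\max_i|\theta_i|\le B\}$. Prior. Let $\pi$ be a probability distribution on $\{1,\dots,n\}$ and $g_1,\dots,g_n$ probability densities on $\mathbb R$. The prior $\Pi$ on $\mathbb R^n$ is the law of $\theta$ obtained as follows: draw $k\sim\pi$; given $k$, draw $A$ uniformly from the subsets of $\{2,\dots,n\}$ of size $k-1$; given $A$, draw independently $\theta_i\sim g_i$ for $i\in A\cup\{1\}$, and put $\theta_i=\theta_{i-1}$ for all other $i$. Suppose that (MC1) $\sum_{j=l}^n\pi(j)\le C_1n^{-C_2l}$ for all integers $l\ge2$; (MC2) $\pi(k^*)\ge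 C_3n^{-C_4k^*}$; (MC3) $g_i(x)\ge c$ for all $i\in\{1,\dots,n\}$ and all $|x|\le B+1$. Variational posterior. Let $\Pi(\cdot\mid X)$ be the posterior distribution, let $\mathcal S_{\rm MC}$ be the set of all laws of first-order Markov chains on $\mathbb R^n$, that is, all $dQ(\theta)=dQ_1(\theta_1)\prod_{j=2}^n dQ_j(\theta_j\mid\theta_{j-1})$ with a probability measure $Q_1$ and Markov kernels $Q_2,\dots,Q_n$ on $\mathbb R$, and let $\widehat Q_{\rm MC}$ be a (measurable in $X$) minimizer of the Kullback–Leibler divergence $D(Q\,\|\,\Pi(\cdot\mid X))$ over $Q\in\mathcal S_{\rm MC}$. Conclusion. For every $\theta^*\in\Theta_{k^*}(B)$, $$P_{\theta^*}^{(n)}\,\widehat Q_{\rm MC}\,\|\theta-\theta^*\|^2\;\le\; M\,k^*\log n ,$$ where the left side is the expectation over $X\sim P^{(n)}_{\theta^*}$ of the mean of $\|\theta-\theta^*\|^2$ (squared Euclidean norm) under $\theta\sim\widehat Q_{\rm MC}$. -/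

import Mathlib

open MeasureTheory ProbabilityTheory
open scoped ENNReal NNReal

namespace PiecewiseConstant

/-- The class of vectors in `ℝⁿ` that are piecewise constant with at most `k` pieces. The entries are
numbered from `0` to `n - 1`, so that the `j`-th piece consists of the `i` with
`a j ≤ i < a (j + 1)`. -/
def pieceClass (n k : ℕ) : Set (Fin n → ℝ) :=
  {θ | ∃ (a : Fin (k + 1) → ℕ) (μ : Fin k → ℝ), a 0 = 0 ∧ Monotone a ∧ a (Fin.last k) = n ∧
    ∀ (j : Fin k) (i : Fin n), a j.castSucc ≤ (i : ℕ) → (i : ℕ) < a j.succ → θ i = μ j}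

/-- The members of `pieceClass n k` with sup-norm at most `B`. -/
def boundedPieceClass (n k : ℕ) (B : ℝ) : Set (Fin n → ℝ) :=
  {θ | θ ∈ pieceClass n k ∧ ∀ i, |θ i| ≤ B}

/-- The sampling distribution `N(θ, σ² Iₙ)`. -/
noncomputable def model {n : ℕ} (σ : ℝ) (θ : Fin n → ℝ) : Measure (Fin n → ℝ) :=
  Measure.pi fun i => gaussianReal (θ i) (σ ^ 2).toNNReal

/-- The likelihood, that is, the Lebesgue density of `N(θ, σ² Iₙ)` at the observation `x`. -/
noncomputable def likelihood {n : ℕ} (σ : ℝ) (x θ : Fin n → ℝ) : ℝ≥0∞ :=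
  ∏ i, gaussianPDF (θ i) (σ ^ 2).toNNReal (x i)

/-- The vector with change points `A` built from the fresh draws `η`: the first entry is `η 0`, the
entry at `i ∈ A` is `η i`, and every other entry repeats its predecessor. -/
def fill {n : ℕ} (A : Finset (Fin n)) (η : Fin n → ℝ) : Fin n → ℝ
  | ⟨0, h⟩ => η ⟨0, h⟩
  | ⟨i + 1, h⟩ =>
    if (⟨i + 1, h⟩ : Fin n) ∈ A then η ⟨i + 1, h⟩ else fill A η ⟨i, Nat.lt_of_succ_lt h⟩

theorem measurable_fill {n : ℕ} (A : Finset (Fin n)) : Measurable (fill A) := by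
  refine measurable_pi_lambda _ ?_
  rintro ⟨i, h⟩
  induction i with
  | zero => simpa only [fill] using measurable_pi_apply _
  | succ i ih =>
    simp only [fill]
    split_ifs
    · exact measurable_pi_apply _
    · exact ih _

/-- The law of the parameter given the set `A` of change points, with independent draws from the
densities `g i`. -/
noncomputable def priorGiven {n : ℕ} (g : Fin n → ℝ → ℝ) (A : Finset (Fin n)) :
    Measure (Fin n → ℝ) :=
  (Measure.pi fun i => volume.withDensity fun x => ENNReal.ofReal (g i x)).map (fill A)

/-- The prior: the number of pieces `k` has probability `w k`, the set `A` of change points is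
uniform among the subsets of size `k - 1` of all positions but the first, and the parameter given
`A` has law `priorGiven g A`. -/
noncomputable def prior {n : ℕ} (w : ℕ → ℝ) (g : Fin n → ℝ → ℝ) : Measure (Fin n → ℝ) :=
  ∑ k ∈ Finset.Icc 1 n, ENNReal.ofReal (w k) •
    ∑ A ∈ Finset.powersetCard (k - 1) (Finset.univ.filter fun i : Fin n => (i : ℕ) ≠ 0),
      ((Nat.choose (n - 1) (k - 1) : ℝ≥0∞)⁻¹) • priorGiven g A

/-- The posterior of the prior `P₀` at the observation `x`. -/
noncomputable def posterior {n : ℕ} (σ : ℝ) (P₀ : Measure (Fin n → ℝ)) (x : Fin n → ℝ) :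
    Measure (Fin n → ℝ) :=
  (∫⁻ θ, likelihood σ x θ ∂P₀)⁻¹ • P₀.withDensity (likelihood σ x)

/-- The law on `ℝⁿ` of a first-order Markov chain with initial law `μ`, where `κ j` is the
conditional law of entry `j` given entry `j - 1` (entries numbered from `0`). -/
noncomputable def chainLaw (μ : Measure ℝ) (κ : ℕ → Kernel ℝ ℝ) :
    (n : ℕ) → Measure (Fin n → ℝ)
  | 0 => Measure.dirac fun _ => 0
  | 1 => μ.map fun x _ => x
  | m + 2 =>
    (chainLaw μ κ (m + 1) ⊗ₘ
      (κ (m + 1)).comap (fun θ => θ (Fin.last m)) (measurable_pi_apply _)).map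
      fun p => Fin.snoc (α := fun _ => ℝ) p.1 p.2

theorem measurable_snoc (m : ℕ) : Measurable fun p : (Fin m → ℝ) × ℝ =>
    (Fin.snoc (α := fun _ => ℝ) p.1 p.2 : Fin (m + 1) → ℝ) := by
  refine measurable_pi_lambda _ fun i => ?_
  refine Fin.lastCases ?_ (fun j => ?_) i
  · simpa using measurable_snd
  · simpa [Function.comp_def] using (measurable_pi_apply j).comp measurable_fst

/-- The variational class of laws of first-order Markov chains on `ℝⁿ`. -/
def markovClass (n : ℕ) : Set (Measure (Fin n → ℝ)) :=
  {Q | ∃ (μ : Measure ℝ) (κ : ℕ → Kernel ℝ ℝ), IsProbabilityMeasure μ ∧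
    (∀ j, IsMarkovKernel (κ j)) ∧ Q = chainLaw μ κ n}

/-- `Q` minimizes the Kullback-Leibler divergence to the posterior `P` over the class `S`. -/
def IsVariationalPosterior {n : ℕ} (S : Set (Measure (Fin n → ℝ))) (P Q : Measure (Fin n → ℝ)) :
    Prop :=
  Q ∈ S ∧ IsMinOn (fun Q' => InformationTheory.klDiv Q' P) S Q

end PiecewiseConstant

/-! The argument combines the Gibbs variational principle with an exact cancellation of the
evidence. Write `z = x - θ*`, let `ℓ` be the log-likelihood ratio against `θ*`, and let `f = a‖θ -
θ*‖²`. Donsker-Varadhan and the minimality of `Q'` give `Q' f ≤ D(Q‖P) + log P(exp f)` for the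
posterior `P` and every chain law `Q`. If `Q ≤ R • P₀` and `ℓ ≥ -t` holds `Q`-almost surely, the
first term is at most `log R + t + log L`, where `L = P₀(exp ℓ)`. The second is `log P₀(exp (f + ℓ))
- log L`. Hence `log L` disappears, no lower bound on the evidence is needed, and no tests are
needed either (`lintegral_le_of_klDiv_le`).

Competitor: fix the change points of `θ*` and condition each of the `k` fresh draws to lie within
`1/n` of the corresponding value of `θ*`. Given its change points the parameter is a Markov chain,
so this law is admissible. Its price `log R` is of order `k log n` by (MC2) and (MC3), and `t` has
bounded mean (`exists_mem_markovClass_near`, `neg_le_logRatio`).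

Exponential moment: for fixed change points `A`, `f + ℓ` is a concave quadratic on a space of
vectors with few pieces, so its maximum is a multiple of the squared projection of `z`. A power `s <
1` passes inside the mixture over `A` by subadditivity and makes that multiple small enough for a
finite chi-square moment. The resulting factor `K ^ (l + k)` and the number of sets `A` are beaten
by (MC1) (`exists_evidence_bound`, `exists_weight_bound`). This bounds the mean of the `s`-th power
by `n D K ^ k`, whose logarithm is of order `k log n`. -/

namespace PiecewiseConstant

/-! ### Kullback-Leibler divergence: the variational inequality and the bound from a bounded
density. -/

section KullbackLeibler

open InformationTheory

variable {α : Type*} {mα : MeasurableSpace α}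

/-- The Fenchel-Young inequality for `klFun`. -/
theorem mul_add_one_le_klFun_add_exp {u : ℝ} (hu : 0 ≤ u) (y : ℝ) :
    u * y + 1 ≤ klFun u + Real.exp y := by
  rw [klFun_apply]
  rcases hu.eq_or_lt with rfl | hu
  · simp [Real.exp_nonneg]
  · have h := Real.add_one_le_exp (y - Real.log u)
    rw [Real.exp_sub, Real.exp_log hu, le_div_iff₀ hu] at h
    nlinarith

/-- The Donsker-Varadhan inequality for nonnegative functions. -/
theorem lintegral_le_klDiv_add (Q P : Measure α) [IsProbabilityMeasure Q] [IsProbabilityMeasure P]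
    {f : α → ℝ} (hf : Measurable f) (hf0 : ∀ x, 0 ≤ f x) {c : ℝ} (hc0 : 0 ≤ c)
    (hc : ∫⁻ x, ENNReal.ofReal (Real.exp (f x)) ∂P ≤ ENNReal.ofReal (Real.exp c)) :
    ∫⁻ x, ENNReal.ofReal (f x) ∂Q ≤ klDiv Q P + ENNReal.ofReal c := by
  by_cases hQP : Q ≪ P
  swap
  · simp [klDiv_of_not_ac hQP]
  rw [klDiv_eq_lintegral_klFun_of_ac hQP,
    ← lintegral_rnDeriv_mul hQP (f := fun x => ENNReal.ofReal (f x)) (by fun_prop)]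
  -- Fenchel-Young at `f x - c`, arranged so that every term is nonnegative; after integration the
  -- `exp` term is at most `1` and cancels the `1` on the left.
  have hpt : ∀ᵐ x ∂P, Q.rnDeriv P x * ENNReal.ofReal (f x) + 1 ≤
      ENNReal.ofReal (klFun (Q.rnDeriv P x).toReal) +
        ENNReal.ofReal (Real.exp (f x)) * ENNReal.ofReal (Real.exp (-c)) +
        Q.rnDeriv P x * ENNReal.ofReal c := by
    filter_upwards [Q.rnDeriv_ne_top P] with x hx
    set u := (Q.rnDeriv P x).toReal with hu
    have hu0 : 0 ≤ u := ENNReal.toReal_nonneg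
    rw [← ENNReal.ofReal_toReal hx, ← hu, ← ENNReal.ofReal_mul hu0, ← ENNReal.ofReal_mul hu0,
      ← ENNReal.ofReal_mul (Real.exp_nonneg _), ← ENNReal.ofReal_one,
      ← ENNReal.ofReal_add (mul_nonneg hu0 (hf0 x)) zero_le_one,
      ← ENNReal.ofReal_add (klFun_nonneg hu0) (by positivity),
      ← ENNReal.ofReal_add (add_nonneg (klFun_nonneg hu0) (by positivity)) (by positivity)]
    apply ENNReal.ofReal_le_ofReal
    have h := mul_add_one_le_klFun_add_exp hu0 (f x - c)
    rw [sub_eq_add_neg, Real.exp_add] at h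
    linarith
  have h := lintegral_mono_ae hpt
  rw [lintegral_add_right _ measurable_const, lintegral_add_right _ (by fun_prop),
    lintegral_add_right _ (by fun_prop), lintegral_mul_const _ (by fun_prop),
    lintegral_mul_const _ (by fun_prop), Measure.lintegral_rnDeriv hQP] at h
  simp only [lintegral_const, measure_univ, mul_one, one_mul] at h
  have h2 : (∫⁻ x, ENNReal.ofReal (Real.exp (f x)) ∂P) * ENNReal.ofReal (Real.exp (-c)) ≤ 1 := by
    refine (mul_le_mul_left hc _).trans ?_
    rw [← ENNReal.ofReal_mul (Real.exp_nonneg _), ← Real.exp_add]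
    simp
  rw [← ENNReal.add_le_add_iff_right ENNReal.one_ne_top]
  refine h.trans ?_
  calc _ ≤ ∫⁻ x, ENNReal.ofReal (klFun (Q.rnDeriv P x).toReal) ∂P + 1 + ENNReal.ofReal c := by
        gcongr
    _ = _ := by ring

/-- The divergence is the `Q`-mean of the log-density, which is at most `v`; total masses force `v ≥
0`. -/
theorem klDiv_le_of_le_smul (Q P : Measure α) [IsProbabilityMeasure Q] [IsProbabilityMeasure P]
    {v : ℝ} (h : Q ≤ ENNReal.ofReal (Real.exp v) • P) :
    0 ≤ v ∧ klDiv Q P ≤ ENNReal.ofReal v := by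
  have hv : 0 ≤ v := by
    have := h Set.univ
    simp only [measure_univ, Measure.smul_apply, smul_eq_mul, mul_one] at this
    rwa [ENNReal.one_le_ofReal, Real.one_le_exp_iff] at this
  refine ⟨hv, ?_⟩
  have hQP : Q ≪ P := (Measure.absolutelyContinuous_of_le h).trans Measure.smul_absolutelyContinuous
  have hle : ∀ᵐ x ∂P, Q.rnDeriv P x ≤ ENNReal.ofReal (Real.exp v) := by
    refine ae_le_of_forall_setLIntegral_le_of_sigmaFinite (Measure.measurable_rnDeriv _ _)
      fun s _ _ => ?_
    refine (Measure.setLIntegral_rnDeriv_le s).trans ((h s).trans ?_)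
    simp
  have hpt : ∀ᵐ x ∂P, ENNReal.ofReal (klFun (Q.rnDeriv P x).toReal) + Q.rnDeriv P x ≤
      Q.rnDeriv P x * ENNReal.ofReal v + 1 := by
    filter_upwards [Q.rnDeriv_ne_top P, hle] with x hx hxv
    set u := (Q.rnDeriv P x).toReal with hu
    have hu0 : 0 ≤ u := ENNReal.toReal_nonneg
    have huv : u ≤ Real.exp v := ENNReal.toReal_le_of_le_ofReal (Real.exp_nonneg _) hxv
    rw [← ENNReal.ofReal_toReal hx, ← hu, ← ENNReal.ofReal_mul hu0, ← ENNReal.ofReal_one,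
      ← ENNReal.ofReal_add (mul_nonneg hu0 hv) zero_le_one,
      ← ENNReal.ofReal_add (klFun_nonneg hu0) hu0]
    apply ENNReal.ofReal_le_ofReal
    rw [klFun_apply]
    rcases hu0.eq_or_lt with h0 | h0
    · simp [← h0]
    · have := mul_le_mul_of_nonneg_left ((Real.log_le_iff_le_exp h0).2 huv) hu0
      linarith
  have h := lintegral_mono_ae hpt
  rw [lintegral_add_right _ measurable_const, lintegral_add_right _ (by fun_prop),
    lintegral_mul_const _ (by fun_prop), Measure.lintegral_rnDeriv hQP,
    ← klDiv_eq_lintegral_klFun_of_ac hQP] at h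
  simp only [lintegral_const, measure_univ, mul_one, one_mul] at h
  exact (ENNReal.add_le_add_iff_right ENNReal.one_ne_top).1 h

end KullbackLeibler

/-! ### Gaussian exponential moments of squared projections. -/

section Gaussian

/-- The moment generating function of the square of a standard Gaussian variable. -/
noncomputable def gaussianSqMgf (c : ℝ) : ℝ≥0∞ :=
  ∫⁻ z, ENNReal.ofReal (Real.exp (c * z ^ 2)) ∂gaussianReal 0 1

theorem one_le_gaussianSqMgf {c : ℝ} (hc : 0 ≤ c) : 1 ≤ gaussianSqMgf c := by
  have : ∫⁻ _, 1 ∂gaussianReal 0 1 ≤ gaussianSqMgf c := by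
    refine lintegral_mono fun z => ?_
    rw [ENNReal.one_le_ofReal, Real.one_le_exp_iff]
    positivity
  simpa using this

theorem gaussianSqMgf_lt_top {c : ℝ} (hc : c < 1 / 2) : gaussianSqMgf c < ∞ := by
  rw [gaussianSqMgf, gaussianReal_of_var_ne_zero _ one_ne_zero,
    lintegral_withDensity_eq_lintegral_mul _ (measurable_gaussianPDF _ _) (by fun_prop)]
  have h := ((integrable_exp_neg_mul_sq (b := 1 / 2 - c) (by linarith)).const_mul
    (√(2 * Real.pi * (1 : ℝ≥0)))⁻¹).lintegral_lt_top
  refine lt_of_eq_of_lt (lintegral_congr fun z => ?_) h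
  rw [Pi.mul_apply, gaussianPDF, ← ENNReal.ofReal_mul (gaussianPDFReal_nonneg _ _ _),
    gaussianPDFReal, mul_assoc, ← Real.exp_add]
  congr 3
  simp
  ring

theorem lintegral_exp_mul_sub_gaussianReal (m : ℝ) (v : ℝ≥0) (t : ℝ) :
    ∫⁻ x, ENNReal.ofReal (Real.exp (t * (x - m))) ∂gaussianReal m v =
      ENNReal.ofReal (Real.exp (v * t ^ 2 / 2)) := by
  have h := mgf_id_gaussianReal (μ := m) (v := v)
  have h1 := congrFun h t
  simp only [mgf, id] at h1
  have hi := (integrable_exp_mul_gaussianReal (μ := m) (v := v) t).const_mul (Real.exp (-(t * m)))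
  rw [← ofReal_integral_eq_lintegral_ofReal]
  · congr 1
    calc ∫ x, Real.exp (t * (x - m)) ∂gaussianReal m v
        = ∫ x, Real.exp (-(t * m)) * Real.exp (t * x) ∂gaussianReal m v := by
          refine integral_congr_ae (ae_of_all _ fun x => ?_)
          simp only
          rw [← Real.exp_add]
          ring_nf
      _ = _ := by
          rw [integral_const_mul, h1, ← Real.exp_add]
          ring_nf
  · refine hi.congr (ae_of_all _ fun x => ?_)
    simp only
    rw [← Real.exp_add]
    ring_nf
  · exact ae_of_all _ fun x => Real.exp_nonneg _

theorem lintegral_pi_prod {ι : Type*} [Fintype ι] (μ : ι → Measure ℝ)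
    [∀ i, IsProbabilityMeasure (μ i)] {f : ι → ℝ → ℝ≥0∞} (hf : ∀ i, Measurable (f i)) :
    ∫⁻ x, ∏ i, f i (x i) ∂Measure.pi μ = ∏ i, ∫⁻ y, f i y ∂μ i := by
  have h := lintegral_prod_eq_prod_lintegral_of_indepFun (μ := Measure.pi μ) Finset.univ
    (fun i x => f i (x i))
    (iIndepFun_pi (X := f) fun i => (hf i).aemeasurable)
    (fun i => (hf i).comp (measurable_pi_apply i))
  rw [h]
  refine Finset.prod_congr rfl fun i _ => ?_
  rw [← (measurePreserving_eval μ i).lintegral_comp (hf i)]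

theorem ofReal_exp_sum {ι : Type*} (s : Finset ι) (f : ι → ℝ) :
    ENNReal.ofReal (Real.exp (∑ i ∈ s, f i)) = ∏ i ∈ s, ENNReal.ofReal (Real.exp (f i)) := by
  rw [Real.exp_sum, ENNReal.ofReal_prod_of_nonneg fun i _ => Real.exp_nonneg _]

/-- The squared norm of the orthogonal projection of `z` on the vectors that are constant on the
fibres of `b`. -/
noncomputable def fiberSq {ι κ : Type*} [Fintype ι] [Fintype κ] [DecidableEq κ] (b : ι → κ)
    (z : ι → ℝ) : ℝ :=
  ∑ β, (∑ i with b i = β, z i) ^ 2 / (Finset.card {i | b i = β} : ℝ)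

variable {ι κ : Type*} [Fintype ι] [Fintype κ] [DecidableEq κ]

theorem measurable_fiberSq (b : ι → κ) : Measurable (fiberSq b) := by
  unfold fiberSq
  fun_prop

/-- Completing the square on each fibre. The bound is uniform in `δ`, so it replaces an integral
over the parameter by a function of the noise alone. -/
theorem sum_sub_sq_le_fiberSq (b : ι → κ) (z δ : ι → ℝ) (d : κ → ℝ) (hδ : ∀ i, δ i = d (b i))
    {p q : ℝ} (hq : 0 < q) :
    p * ∑ i, z i * δ i - q * ∑ i, δ i ^ 2 ≤ p ^ 2 / (4 * q) * fiberSq b z := by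
  rw [← Finset.sum_fiberwise _ b, ← Finset.sum_fiberwise _ b fun i => δ i ^ 2, fiberSq,
    Finset.mul_sum, Finset.mul_sum, Finset.mul_sum, ← Finset.sum_sub_distrib]
  refine Finset.sum_le_sum fun β _ => ?_
  have h1 : ∑ i with b i = β, z i * δ i = (∑ i with b i = β, z i) * d β := by
    rw [Finset.sum_mul]
    refine Finset.sum_congr rfl fun i hi => ?_
    rw [hδ, (Finset.mem_filter.1 hi).2]
  have h2 : ∑ i with b i = β, δ i ^ 2 = (Finset.card {i | b i = β} : ℝ) * d β ^ 2 := by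
    rw [← nsmul_eq_mul, ← Finset.sum_const]
    refine Finset.sum_congr rfl fun i hi => ?_
    rw [hδ, (Finset.mem_filter.1 hi).2]
  rw [h1, h2]
  rcases Nat.eq_zero_or_pos (Finset.card {i | b i = β}) with h0 | h0
  · rw [Finset.card_eq_zero] at h0
    simp [h0]
  · have hm : (0 : ℝ) < (Finset.card {i | b i = β} : ℝ) := by exact_mod_cast h0
    set m := (Finset.card {i | b i = β} : ℝ)
    set S := ∑ i with b i = β, z i
    have : p ^ 2 / (4 * q) * (S ^ 2 / m) - (p * (S * d β) - q * (m * d β ^ 2)) =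
        (p * S - 2 * q * m * d β) ^ 2 / (4 * q * m) := by
      field_simp
      ring
    have h3 : 0 ≤ (p * S - 2 * q * m * d β) ^ 2 / (4 * q * m) := by positivity
    linarith

/-- A chi-square moment with at most one degree of freedom per label, obtained without changing to
an orthonormal basis: an auxiliary standard Gaussian `g` linearizes each square, and after
exchanging the integrals the coordinates of `x` are independent. -/
theorem lintegral_exp_fiberSq_le (b : ι → κ) (m : ι → ℝ) (v : ℝ≥0) {t : ℝ} (ht : 0 ≤ t) :
    ∫⁻ x, ENNReal.ofReal (Real.exp (t * fiberSq b fun i => x i - m i))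
        ∂Measure.pi (fun i => gaussianReal (m i) v) ≤
      gaussianSqMgf (v * t) ^ Fintype.card κ := by
  set N : κ → ℝ := fun β => (Finset.card {i | b i = β} : ℝ) with hN
  have hN0 : ∀ β, 0 ≤ N β := fun β => Nat.cast_nonneg _
  have hsq : √(2 * t) ^ 2 = 2 * t := Real.sq_sqrt (by positivity)
  -- `exp (t S² / N)` is the mean of `exp (√(2t) g S / √N)` over a standard Gaussian `g`.
  have hlin : ∀ x : ι → ℝ, ENNReal.ofReal (Real.exp (t * fiberSq b fun i => x i - m i)) =
      ∫⁻ g : κ → ℝ, ENNReal.ofReal (Real.exp (∑ i, √(2 * t) * g (b i) / √(N (b i)) *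
        (x i - m i))) ∂Measure.pi (fun _ => gaussianReal 0 1) := by
    intro x
    have h1 : ∀ g : κ → ℝ, ENNReal.ofReal (Real.exp (∑ i, √(2 * t) * g (b i) / √(N (b i)) *
        (x i - m i))) = ∏ β, ENNReal.ofReal (Real.exp
          ((√(2 * t) * (∑ i with b i = β, (x i - m i)) / √(N β)) * (g β - 0))) := by
      intro g
      rw [← ofReal_exp_sum, ← Finset.sum_fiberwise _ b]
      congr 3
      funext β
      rw [Finset.mul_sum, Finset.sum_div, Finset.sum_mul]
      refine Finset.sum_congr rfl fun i hi => ?_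
      rw [(Finset.mem_filter.1 hi).2]
      ring
    simp_rw [h1]
    rw [lintegral_pi_prod (f := fun β z => ENNReal.ofReal (Real.exp
      ((√(2 * t) * (∑ i with b i = β, (x i - m i)) / √(N β)) * (z - 0)))) _ fun β => by fun_prop]
    simp_rw [lintegral_exp_mul_sub_gaussianReal]
    rw [← ofReal_exp_sum, fiberSq, Finset.mul_sum]
    congr 3
    funext β
    rw [div_pow, mul_pow, Real.sq_sqrt (hN0 β), hsq]
    simp only [NNReal.coe_one, hN]
    ring
  simp_rw [hlin]
  rw [lintegral_lintegral_swap (by fun_prop)]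
  have hprod : ∫⁻ g : κ → ℝ, ∏ β, ENNReal.ofReal (Real.exp (v * t * g β ^ 2))
      ∂Measure.pi (fun _ => gaussianReal 0 1) = gaussianSqMgf (v * t) ^ Fintype.card κ := by
    rw [lintegral_pi_prod (f := fun _ z => ENNReal.ofReal (Real.exp (v * t * z ^ 2))) _
      fun β => by fun_prop]
    simp [gaussianSqMgf]
  rw [← hprod]
  refine lintegral_mono fun g => ?_
  simp only
  simp_rw [ofReal_exp_sum]
  rw [lintegral_pi_prod (f := fun i z => ENNReal.ofReal (Real.exp
      (√(2 * t) * g (b i) / √(N (b i)) * (z - m i)))) _ fun i => by fun_prop]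
  simp_rw [lintegral_exp_mul_sub_gaussianReal]
  rw [← ofReal_exp_sum, ← ofReal_exp_sum, ← Finset.sum_fiberwise _ b]
  refine ENNReal.ofReal_le_ofReal (Real.exp_le_exp.2 (Finset.sum_le_sum fun β _ => ?_))
  have h2 : ∑ i with b i = β, (v : ℝ) * (√(2 * t) * g (b i) / √(N (b i))) ^ 2 / 2 =
      N β * (v * t * g β ^ 2 / N β) := by
    rw [← nsmul_eq_mul, ← Finset.sum_const]
    refine Finset.sum_congr rfl fun i hi => ?_
    rw [(Finset.mem_filter.1 hi).2, div_pow, mul_pow, Real.sq_sqrt (hN0 β), hsq]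
    ring
  rw [h2]
  -- An empty fibre contributes `0` on the left only; this is why the lemma is an inequality.
  rcases (hN0 β).eq_or_lt with h0 | h0
  · rw [← h0, zero_mul]
    positivity
  · rw [mul_div_cancel₀ _ h0.ne']

end Gaussian

/-! ### Change points and pieces. -/

section Combinatorics

variable {n : ℕ}

/-- The vector `δ` only changes at the positions in `A`. -/
def ChangesOnlyAt (A : Finset (Fin n)) (δ : Fin n → ℝ) : Prop :=
  ∀ (i : ℕ) (h : i + 1 < n), (⟨i + 1, h⟩ : Fin n) ∉ A →
    δ ⟨i + 1, h⟩ = δ ⟨i, Nat.lt_of_succ_lt h⟩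

theorem ChangesOnlyAt.mono {A A' : Finset (Fin n)} (hA : A ⊆ A') {δ : Fin n → ℝ}
    (hδ : ChangesOnlyAt A δ) : ChangesOnlyAt A' δ :=
  fun i h hi => hδ i h fun h' => hi (hA h')

theorem changesOnlyAt_fill (A : Finset (Fin n)) (η : Fin n → ℝ) : ChangesOnlyAt A (fill A η) := by
  intro i h hi
  rw [fill, if_neg hi]

theorem ChangesOnlyAt.sub {A : Finset (Fin n)} {δ δ' : Fin n → ℝ} (hδ : ChangesOnlyAt A δ)
    (hδ' : ChangesOnlyAt A δ') : ChangesOnlyAt A fun i => δ i - δ' i :=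
  fun i h hi => by simp only [hδ i h hi, hδ' i h hi]

/-- Each position is labelled by the start of its piece. The labelling does not depend on `δ`, so it
identifies one linear space of dimension at most `A.card + 1` containing all such vectors. -/
theorem exists_label (hn : 0 < n) (A : Finset (Fin n)) :
    ∃ b : Fin n → (insert ⟨0, hn⟩ A : Finset (Fin n)),
      ∀ δ : Fin n → ℝ, ChangesOnlyAt A δ → ∀ i, δ i = δ (b i) := by
  have h : ∀ i : Fin n, ∃ j : (insert ⟨0, hn⟩ A : Finset (Fin n)),
      ∀ δ : Fin n → ℝ, ChangesOnlyAt A δ → δ i = δ j := by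
    rintro ⟨i, hi⟩
    induction i with
    | zero => exact ⟨⟨⟨0, hn⟩, Finset.mem_insert_self _ _⟩, fun δ _ => rfl⟩
    | succ i ih =>
      by_cases hA : (⟨i + 1, hi⟩ : Fin n) ∈ A
      · exact ⟨⟨⟨i + 1, hi⟩, Finset.mem_insert_of_mem hA⟩, fun δ _ => rfl⟩
      · obtain ⟨j, hj⟩ := ih (Nat.lt_of_succ_lt hi)
        exact ⟨j, fun δ hδ => (hδ i hi hA).trans (hj δ hδ)⟩
  choose b hb using h
  exact ⟨b, fun δ hδ i => hb i δ hδ⟩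

theorem abs_fill_sub_le (hn : 0 < n) {A : Finset (Fin n)} {η δ : Fin n → ℝ}
    (hδ : ChangesOnlyAt A δ) {r : ℝ} (h : ∀ j ∈ insert ⟨0, hn⟩ A, |η j - δ j| ≤ r) (i : Fin n) :
    |fill A η i - δ i| ≤ r := by
  obtain ⟨i, hi⟩ := i
  induction i with
  | zero =>
    rw [fill]
    exact h _ (Finset.mem_insert_self _ _)
  | succ i ih =>
    by_cases hA : (⟨i + 1, hi⟩ : Fin n) ∈ A
    · rw [fill, if_pos hA]
      exact h _ (Finset.mem_insert_of_mem hA)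
    · rw [changesOnlyAt_fill A η i hi hA, hδ i hi hA]
      exact ih _

theorem card_filter_ne_zero (hn : 0 < n) :
    (Finset.univ.filter fun i : Fin n => (i : ℕ) ≠ 0).card = n - 1 := by
  have : (Finset.univ.filter fun i : Fin n => (i : ℕ) ≠ 0) =
      Finset.univ.erase (⟨0, hn⟩ : Fin n) := by
    ext i
    simp [Fin.ext_iff]
  rw [this, Finset.card_erase_of_mem (Finset.mem_univ _), Finset.card_univ, Fintype.card_fin]

theorem exists_changesOnlyAt_of_mem_pieceClass {k : ℕ} (hk : 1 ≤ k) (hkn : k ≤ n)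
    {θ : Fin n → ℝ} (hθ : θ ∈ pieceClass n k) :
    ∃ A ∈ Finset.powersetCard (k - 1) (Finset.univ.filter fun i : Fin n => (i : ℕ) ≠ 0),
      ChangesOnlyAt A θ := by
  obtain ⟨a, μ, ha0, hmono, hlast, hθ⟩ := hθ
  set A₀ : Finset (Fin n) := Finset.univ.filter fun i : Fin n => (i : ℕ) ≠ 0 ∧
    ∃ j : Fin (k - 1), a ⟨j + 1, by omega⟩ = i with hA₀
  have hcard₀ : A₀.card ≤ k - 1 := by
    have h1 : A₀.image (fun i : Fin n => (i : ℕ)) ⊆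
        Finset.univ.image fun j : Fin (k - 1) => a ⟨j + 1, by omega⟩ := by
      intro x hx
      obtain ⟨i, hi, rfl⟩ := Finset.mem_image.1 hx
      obtain ⟨-, -, j, hj⟩ := Finset.mem_filter.1 hi
      exact Finset.mem_image.2 ⟨j, Finset.mem_univ _, hj⟩
    have h2 := (Finset.card_le_card h1).trans Finset.card_image_le
    rwa [Finset.card_image_of_injective _ Fin.val_injective, Finset.card_univ,
      Fintype.card_fin] at h2
  have hsub : A₀ ⊆ Finset.univ.filter fun i : Fin n => (i : ℕ) ≠ 0 := by
    intro i hi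
    exact Finset.mem_filter.2 ⟨Finset.mem_univ _, (Finset.mem_filter.1 hi).2.1⟩
  -- Breakpoints may coincide or sit at the ends, so `A₀` can be too small; superfluous change
  -- points are harmless and pad it to size `k - 1`.
  obtain ⟨A, hA₀A, hAsub, hAcard⟩ := Finset.exists_subsuperset_card_eq hsub hcard₀
    (by rw [card_filter_ne_zero (by omega)]; omega)
  refine ⟨A, Finset.mem_powersetCard.2 ⟨hAsub, hAcard⟩, ?_⟩
  refine ChangesOnlyAt.mono hA₀A fun i h hi => ?_
  -- The first breakpoint beyond `i` is not `i + 1`, since `i + 1 ∉ A₀`; hence `i` and `i + 1` lie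
  -- in the same piece.
  have hex : ∃ j : ℕ, ∃ hj : j < k + 1, i < a ⟨j, hj⟩ :=
    ⟨k, Nat.lt_succ_self k, by
      have : a ⟨k, Nat.lt_succ_self k⟩ = n := hlast
      omega⟩
  classical
  obtain ⟨hj, hij⟩ := Nat.find_spec hex
  obtain ⟨j, hj0⟩ : ∃ j, Nat.find hex = j + 1 := by
    refine Nat.exists_eq_succ_of_ne_zero fun h0 => ?_
    simp only [h0] at hij
    have : a ⟨0, by omega⟩ = 0 := ha0
    omega
  simp only [hj0] at hj hij
  have hjlt : ¬ ∃ hj : j < k + 1, i < a ⟨j, hj⟩ := Nat.find_min hex (by omega)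
  have hji : a ⟨j, by omega⟩ ≤ i := by
    by_contra hlt
    exact hjlt ⟨by omega, by omega⟩
  have hne : a ⟨j + 1, hj⟩ ≠ i + 1 := by
    intro heq
    apply hi
    refine Finset.mem_filter.2 ⟨Finset.mem_univ _, Nat.succ_ne_zero i, ⟨j, ?_⟩, heq⟩
    by_contra hjk
    have hk' : j + 1 = k := by omega
    subst hk'
    have : a ⟨j + 1, hj⟩ = n := hlast
    omega
  rw [hθ ⟨j, by omega⟩ ⟨i + 1, h⟩ (by simp only [Fin.castSucc_mk]; omega)
      (by simp only [Fin.succ_mk]; omega),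
    hθ ⟨j, by omega⟩ ⟨i, by omega⟩ hji hij]

end Combinatorics

/-! ### Fixed change points give a Markov chain. -/

section Chains

instance isProbabilityMeasure_chainLaw (μ : Measure ℝ) [IsProbabilityMeasure μ]
    (κ : ℕ → Kernel ℝ ℝ) [∀ j, IsMarkovKernel (κ j)] (n : ℕ) :
    IsProbabilityMeasure (chainLaw μ κ n) := by
  induction n using Nat.twoStepInduction with
  | zero => rw [chainLaw]; infer_instance
  | one =>
    rw [chainLaw]
    exact Measure.isProbabilityMeasure_map (by fun_prop)
  | more m _ ih =>
    rw [chainLaw]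
    exact Measure.isProbabilityMeasure_map (measurable_snoc _).aemeasurable

theorem isProbabilityMeasure_of_mem_markovClass {n : ℕ} {Q : Measure (Fin n → ℝ)}
    (hQ : Q ∈ markovClass n) : IsProbabilityMeasure Q := by
  obtain ⟨μ, κ, hμ, hκ, rfl⟩ := hQ
  infer_instance

theorem lintegral_pi_snoc {m : ℕ} (ν : ℕ → Measure ℝ) [∀ j, IsProbabilityMeasure (ν j)]
    {f : (Fin (m + 1) → ℝ) → ℝ≥0∞} (hf : Measurable f) :
    ∫⁻ ζ, f ζ ∂Measure.pi (fun i : Fin (m + 1) => ν i) =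
      ∫⁻ η, ∫⁻ y, f (Fin.snoc (α := fun _ => ℝ) η y) ∂ν m
        ∂Measure.pi (fun i : Fin m => ν i) := by
  have h := (measurePreserving_piFinSuccAbove (fun i : Fin (m + 1) => ν i) (Fin.last m)).symm
  have h2 := h.lintegral_comp hf
  simp only [Fin.succAbove_last, Fin.val_castSucc, Fin.val_last] at h2
  have h3 := lintegral_prod_symm (μ := ν m) (ν := Measure.pi fun i : Fin m => ν i) _
    (hf.comp (MeasurableEquiv.piFinSuccAbove (fun _ => ℝ) (Fin.last m)).symm.measurable).aemeasurable
  rw [← h2]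
  refine h3.trans ?_
  refine lintegral_congr fun η => lintegral_congr fun y => ?_
  exact congrArg f (Fin.insertNth_last' y η)

variable (p : ℕ → Prop) [DecidablePred p]

/-- Matches the recursion of `fill` with that of `chainLaw`, which appends the last entry. Change
points are given by a predicate on `ℕ` so that one `p` serves all lengths. -/
theorem fill_snoc (m : ℕ) (η : Fin (m + 1) → ℝ) (y : ℝ) :
    fill (Finset.univ.filter fun i : Fin (m + 2) => p i) (Fin.snoc (α := fun _ => ℝ) η y) =
      Fin.snoc (α := fun _ => ℝ) (fill (Finset.univ.filter fun i : Fin (m + 1) => p i) η)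
        (if p (m + 1) then y
          else fill (Finset.univ.filter fun i : Fin (m + 1) => p i) η (Fin.last m)) := by
  have hcast : ∀ (i : ℕ) (hi : i < m + 1),
      fill (Finset.univ.filter fun i : Fin (m + 2) => p i) (Fin.snoc (α := fun _ => ℝ) η y)
        ⟨i, by omega⟩ = fill (Finset.univ.filter fun i : Fin (m + 1) => p i) η ⟨i, hi⟩ := by
    intro i hi
    induction i with
    | zero =>
      rw [fill, fill]
      exact Fin.snoc_castSucc (α := fun _ => ℝ) y η ⟨0, hi⟩
    | succ i ih =>
      rw [fill, fill, ih (by omega)]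
      simp only [Finset.mem_filter, Finset.mem_univ, true_and]
      congr 1
      exact Fin.snoc_castSucc (α := fun _ => ℝ) y η ⟨i + 1, hi⟩
  funext i
  refine Fin.lastCases ?_ (fun j => ?_) i
  · rw [Fin.snoc_last]
    change fill _ _ ⟨m + 1, _⟩ = _
    rw [fill, hcast m (by omega)]
    simp only [Finset.mem_filter, Finset.mem_univ, true_and]
    congr 1
    exact Fin.snoc_last (α := fun _ => ℝ) y η
  · rw [Fin.snoc_castSucc]
    exact hcast j j.2

/-- The transition kernels of the chain with change points where `p` holds. -/
noncomputable def changeKernel (ν : ℕ → Measure ℝ) (j : ℕ) : Kernel ℝ ℝ :=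
  if p j then Kernel.const ℝ (ν j) else Kernel.id

instance (ν : ℕ → Measure ℝ) [∀ j, IsProbabilityMeasure (ν j)] (j : ℕ) :
    IsMarkovKernel (changeKernel p ν j) := by
  unfold changeKernel
  split_ifs <;> infer_instance

theorem lintegral_changeKernel (ν : ℕ → Measure ℝ) [∀ j, IsProbabilityMeasure (ν j)] (j : ℕ)
    (z : ℝ) {f : ℝ → ℝ≥0∞} (hf : Measurable f) :
    ∫⁻ y, f y ∂changeKernel p ν j z = ∫⁻ y, f (if p j then y else z) ∂ν j := by
  unfold changeKernel
  split_ifs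
  · rw [Kernel.const_apply]
  · simp [Kernel.id_apply, lintegral_dirac' _ hf]

theorem chainLaw_changeKernel (ν : ℕ → Measure ℝ) [∀ j, IsProbabilityMeasure (ν j)] (m : ℕ) :
    chainLaw (ν 0) (changeKernel p ν) (m + 1) =
      (Measure.pi fun i : Fin (m + 1) => ν i).map
        (fill (Finset.univ.filter fun i : Fin (m + 1) => p i)) := by
  induction m with
  | zero =>
    rw [zero_add, chainLaw]
    have h := (measurePreserving_eval (fun i : Fin 1 => ν i) 0).map_eq
    conv_lhs => rw [← Fin.val_zero 1, ← h]
    rw [Measure.map_map (by fun_prop) (by fun_prop)]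
    congr 1
    funext η i
    rw [Fin.fin_one_eq_zero i]
    exact (fill.eq_1 _ η Nat.zero_lt_one).symm
  | succ m ih =>
    refine Measure.ext_of_lintegral _ fun f hf => ?_
    have hfs : Measurable fun q : (Fin (m + 1) → ℝ) × ℝ =>
        f (Fin.snoc (α := fun _ => ℝ) q.1 q.2) := hf.comp (measurable_snoc _)
    rw [chainLaw, lintegral_map hf (measurable_snoc _), Measure.lintegral_compProd hfs, ih]
    rw [lintegral_map hfs.lintegral_kernel_prod_right' (measurable_fill _),
      lintegral_map hf (measurable_fill _)]
    refine Eq.trans ?_ (lintegral_pi_snoc ν (hf.comp (measurable_fill _))).symm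
    refine lintegral_congr fun η => ?_
    rw [Kernel.comap_apply]
    refine (lintegral_changeKernel p ν (m + 1) _ (hfs.comp measurable_prodMk_left)).trans ?_
    refine lintegral_congr fun y => ?_
    simp only [Function.comp_apply]
    rw [fill_snoc]

/-- For fixed `A` each transition is either an independent draw or a copy of the previous entry. -/
theorem map_fill_mem_markovClass {n : ℕ} (hn : 0 < n) (A : Finset (Fin n))
    (ν : Fin n → Measure ℝ) [∀ i, IsProbabilityMeasure (ν i)] :
    (Measure.pi ν).map (fill A) ∈ markovClass n := by
  classical
  obtain ⟨m, rfl⟩ := Nat.exists_eq_succ_of_ne_zero hn.ne'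
  -- The value beyond `m` never enters the law of the first `m + 1` entries.
  set ν' : ℕ → Measure ℝ := fun j => if h : j < m + 1 then ν ⟨j, h⟩ else Measure.dirac 0 with hν'
  have hprob : ∀ j, IsProbabilityMeasure (ν' j) := by
    intro j
    simp only [hν']
    split_ifs <;> infer_instance
  refine ⟨ν' 0, changeKernel (fun j => ∃ h : j < m + 1, (⟨j, h⟩ : Fin (m + 1)) ∈ A) ν', hprob 0,
    fun j => inferInstance, ?_⟩
  refine Eq.trans ?_ (chainLaw_changeKernel _ ν' m).symm
  congr 2
  · ext i
    simpa using fun _ => Nat.lt_succ_iff.1 i.2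
  · funext i
    simpa [hν'] using fun h => absurd i.2 (by omega)

end Chains

/-! ### The variational bound with the evidence cancelled. -/

section Gibbs

open InformationTheory

variable {α : Type*} {mα : MeasurableSpace α}

/-- With evidence `l`, the density of `Q` against the posterior is at most `R exp(t) l`, while the
posterior mean of `exp f` is at most `y / l`; the two logarithms of `l` cancel in the sum. -/
theorem lintegral_le_of_klDiv_le (P₀ Q Q' : Measure α) [IsProbabilityMeasure P₀]
    [IsProbabilityMeasure Q] [IsProbabilityMeasure Q'] {ℓ f : α → ℝ} (hℓ : Measurable ℓ)
    (hf : Measurable f) (hf0 : ∀ θ, 0 ≤ f θ) {R t y : ℝ} (hR : 0 < R) (hy : 0 < y)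
    (htop : ∫⁻ θ, ENNReal.ofReal (Real.exp (ℓ θ)) ∂P₀ ≠ ∞)
    (hQ : Q ≤ ENNReal.ofReal R • P₀) (hQt : ∀ᵐ θ ∂Q, -t ≤ ℓ θ)
    (hfy : ∫⁻ θ, ENNReal.ofReal (Real.exp (f θ)) * ENNReal.ofReal (Real.exp (ℓ θ)) ∂P₀ ≤
      ENNReal.ofReal y)
    (hkl : ∀ P, P = (∫⁻ θ, ENNReal.ofReal (Real.exp (ℓ θ)) ∂P₀)⁻¹ •
      P₀.withDensity (fun θ => ENNReal.ofReal (Real.exp (ℓ θ))) → klDiv Q' P ≤ klDiv Q P) :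
    ∫⁻ θ, ENNReal.ofReal (f θ) ∂Q' ≤ ENNReal.ofReal (Real.log R + t + Real.log y) := by
  have hmeas : Measurable fun θ => ENNReal.ofReal (Real.exp (ℓ θ)) := by fun_prop
  set L := ∫⁻ θ, ENNReal.ofReal (Real.exp (ℓ θ)) ∂P₀ with hL
  set W := P₀.withDensity (fun θ => ENNReal.ofReal (Real.exp (ℓ θ))) with hW
  have hWL : W Set.univ = L := by rw [hW, withDensity_apply _ MeasurableSet.univ, setLIntegral_univ]
  have hL0 : L ≠ 0 := by
    rw [hL, ne_eq, lintegral_eq_zero_iff hmeas]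
    intro h0
    have : ∀ᵐ θ ∂P₀, False := by
      filter_upwards [h0] with θ hθ
      simp only [Pi.zero_apply, ENNReal.ofReal_eq_zero] at hθ
      exact absurd (Real.exp_pos _) (not_lt.2 hθ)
    rw [ae_iff] at this
    simp at this
  have hkl := hkl (L⁻¹ • W) rfl
  set P := L⁻¹ • W with hP
  have hPprob : IsProbabilityMeasure P :=
    ⟨by rw [hP, Measure.smul_apply, hWL, smul_eq_mul, ENNReal.inv_mul_cancel hL0 htop]⟩
  set l := L.toReal with hl
  have hl0 : 0 < l := ENNReal.toReal_pos hL0 htop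
  have hLl : L = ENNReal.ofReal l := (ENNReal.ofReal_toReal htop).symm
  have hWP : W = L • P := by
    rw [hP, smul_smul, ENNReal.mul_inv_cancel hL0 htop, one_smul]
  clear_value P
  have hle : Q ≤ ENNReal.ofReal (Real.exp (Real.log R + t + Real.log l)) • P := by
    refine Measure.le_iff.2 fun s hs => ?_
    have hE : MeasurableSet {θ | -t ≤ ℓ θ} := measurableSet_le measurable_const hℓ
    have h1 : Q s = Q (s ∩ {θ | -t ≤ ℓ θ}) :=
      measure_congr (inter_ae_eq_left_of_ae_eq_univ (Filter.eventuallyEq_univ.2 hQt)).symm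
    have h2 : P₀ (s ∩ {θ | -t ≤ ℓ θ}) ≤ ENNReal.ofReal (Real.exp t) * W s := by
      calc P₀ (s ∩ {θ | -t ≤ ℓ θ}) = ∫⁻ θ in s ∩ {θ | -t ≤ ℓ θ}, 1 ∂P₀ := by simp
        _ ≤ ∫⁻ θ in s ∩ {θ | -t ≤ ℓ θ},
            ENNReal.ofReal (Real.exp t) * ENNReal.ofReal (Real.exp (ℓ θ)) ∂P₀ := by
          refine setLIntegral_mono' (hs.inter hE) fun θ hθ => ?_
          rw [← ENNReal.ofReal_mul (Real.exp_nonneg _), ← Real.exp_add, ENNReal.one_le_ofReal,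
            Real.one_le_exp_iff]
          have : -t ≤ ℓ θ := hθ.2
          linarith
        _ = ENNReal.ofReal (Real.exp t) * W (s ∩ {θ | -t ≤ ℓ θ}) := by
          rw [lintegral_const_mul _ hmeas, hW, withDensity_apply _ (hs.inter hE)]
        _ ≤ _ := by gcongr; exact Set.inter_subset_left
    calc Q s ≤ ENNReal.ofReal R * P₀ (s ∩ {θ | -t ≤ ℓ θ}) := by rw [h1]; exact hQ _
      _ ≤ ENNReal.ofReal R * (ENNReal.ofReal (Real.exp t) * (L * P s)) := by
        gcongr
        rw [hWP] at h2
        exact h2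
      _ = _ := by
        rw [Real.exp_add, Real.exp_add, Real.exp_log hR, Real.exp_log hl0,
          ENNReal.ofReal_mul (by positivity), ENNReal.ofReal_mul hR.le, Measure.smul_apply, hLl,
          smul_eq_mul]
        ring
  obtain ⟨hv0, hv⟩ := klDiv_le_of_le_smul Q P hle
  have hint : ∫⁻ θ, ENNReal.ofReal (Real.exp (f θ)) ∂P ≤
      ENNReal.ofReal (Real.exp (Real.log y - Real.log l)) := by
    rw [hP, lintegral_smul_measure, hW, lintegral_withDensity_eq_lintegral_mul _ hmeas
      (by fun_prop), Real.exp_sub, Real.exp_log hy, Real.exp_log hl0, div_eq_mul_inv, mul_comm y,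
      ENNReal.ofReal_mul (by positivity), ENNReal.ofReal_inv_of_pos hl0, ← hLl, smul_eq_mul]
    gcongr
    refine le_of_eq_of_le (lintegral_congr fun θ => ?_) hfy
    rw [Pi.mul_apply, mul_comm]
  have hc0 : 0 ≤ Real.log y - Real.log l := by
    have h1 : ∫⁻ _, 1 ∂P ≤ ∫⁻ θ, ENNReal.ofReal (Real.exp (f θ)) ∂P := by
      refine lintegral_mono fun θ => ?_
      rw [ENNReal.one_le_ofReal, Real.one_le_exp_iff]
      exact hf0 θ
    have h2 := h1.trans hint
    rwa [lintegral_const, measure_univ, mul_one, ENNReal.one_le_ofReal, Real.one_le_exp_iff] at h2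
  refine (lintegral_le_klDiv_add Q' P hf hf0 hc0 hint).trans ?_
  refine (add_le_add_left (hkl.trans hv) _).trans ?_
  rw [← ENNReal.ofReal_add hv0 hc0]
  apply ENNReal.ofReal_le_ofReal
  linarith

end Gibbs

/-! ### The prior as a mixture, and the competitor chain. -/

section Prior

variable {n : ℕ} {g : Fin n → ℝ → ℝ}

theorem isProbabilityMeasure_withDensity_ofReal {h : ℝ → ℝ}
    (h1 : ∫⁻ x, ENNReal.ofReal (h x) = 1) :
    IsProbabilityMeasure (volume.withDensity fun x => ENNReal.ofReal (h x)) :=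
  ⟨by rw [withDensity_apply _ MeasurableSet.univ, setLIntegral_univ, h1]⟩

theorem isProbabilityMeasure_priorGiven (hg1 : ∀ i, ∫⁻ x, ENNReal.ofReal (g i x) = 1)
    (A : Finset (Fin n)) : IsProbabilityMeasure (priorGiven g A) := by
  have := fun i => isProbabilityMeasure_withDensity_ofReal (hg1 i)
  exact Measure.isProbabilityMeasure_map (measurable_fill A).aemeasurable

theorem lintegral_prior (w : ℕ → ℝ) (f : (Fin n → ℝ) → ℝ≥0∞) :
    ∫⁻ θ, f θ ∂prior w g = ∑ k ∈ Finset.Icc 1 n, ∑ A ∈ Finset.powersetCard (k - 1)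
      (Finset.univ.filter fun i : Fin n => (i : ℕ) ≠ 0),
        ENNReal.ofReal (w k) * (Nat.choose (n - 1) (k - 1) : ℝ≥0∞)⁻¹ *
          ∫⁻ θ, f θ ∂priorGiven g A := by
  simp only [prior, lintegral_finsetSum_measure, lintegral_smul_measure, smul_eq_mul,
    Finset.mul_sum, mul_assoc]

theorem isProbabilityMeasure_prior (hn : 0 < n) {w : ℕ → ℝ}
    (hw : ∀ j ∈ Finset.Icc 1 n, 0 ≤ w j) (hw1 : ∑ j ∈ Finset.Icc 1 n, w j = 1)
    (hg1 : ∀ i, ∫⁻ x, ENNReal.ofReal (g i x) = 1) : IsProbabilityMeasure (prior w g) := by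
  refine ⟨?_⟩
  have := isProbabilityMeasure_priorGiven hg1
  have h := lintegral_prior (g := g) w (fun _ => 1)
  simp only [lintegral_const, one_mul, measure_univ, mul_one, Finset.sum_const,
    Finset.card_powersetCard, card_filter_ne_zero hn, nsmul_eq_mul] at h
  rw [h, ← ENNReal.ofReal_one, ← hw1, ENNReal.ofReal_sum_of_nonneg hw]
  refine Finset.sum_congr rfl fun k hk => ?_
  have hpos : 0 < Nat.choose (n - 1) (k - 1) :=
    Nat.choose_pos (Nat.sub_le_sub_right (Finset.mem_Icc.1 hk).2 1)
  rw [mul_left_comm, ENNReal.mul_inv_cancel (by exact_mod_cast hpos.ne') (ENNReal.natCast_ne_top _),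
    mul_one]

theorem priorGiven_le_smul_prior {w : ℕ → ℝ} {k : ℕ} (hk : 1 ≤ k) (hkn : k ≤ n) (hwk : 0 < w k)
    {A : Finset (Fin n)} (hA : A ∈ Finset.powersetCard (k - 1)
      (Finset.univ.filter fun i : Fin n => (i : ℕ) ≠ 0)) :
    priorGiven g A ≤ ENNReal.ofReal ((w k)⁻¹ * Nat.choose (n - 1) (k - 1)) • prior w g := by
  have hpos : 0 < Nat.choose (n - 1) (k - 1) := Nat.choose_pos (Nat.sub_le_sub_right hkn 1)
  refine Measure.le_iff.2 fun s hs => ?_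
  have h := lintegral_prior (g := g) w (s.indicator 1)
  simp only [lintegral_indicator_one hs] at h
  rw [Measure.smul_apply, h, smul_eq_mul]
  have h1 : ENNReal.ofReal (w k) * (Nat.choose (n - 1) (k - 1) : ℝ≥0∞)⁻¹ * priorGiven g A s ≤
      ∑ k ∈ Finset.Icc 1 n, ∑ A ∈ Finset.powersetCard (k - 1)
        (Finset.univ.filter fun i : Fin n => (i : ℕ) ≠ 0),
        ENNReal.ofReal (w k) * (Nat.choose (n - 1) (k - 1) : ℝ≥0∞)⁻¹ * priorGiven g A s := by
    refine le_trans ?_ (Finset.single_le_sum (fun _ _ => zero_le) (Finset.mem_Icc.2 ⟨hk, hkn⟩))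
    exact Finset.single_le_sum
      (f := fun A => ENNReal.ofReal (w k) * (Nat.choose (n - 1) (k - 1) : ℝ≥0∞)⁻¹ *
        priorGiven g A s) (fun _ _ => zero_le) hA
  refine le_trans (le_of_eq ?_) (mul_le_mul_right h1 _)
  rw [ENNReal.ofReal_mul (by positivity), ENNReal.ofReal_inv_of_pos hwk, ENNReal.ofReal_natCast]
  have e1 : (ENNReal.ofReal (w k))⁻¹ * ENNReal.ofReal (w k) = 1 :=
    ENNReal.inv_mul_cancel (by simpa using hwk) ENNReal.ofReal_ne_top
  have e2 : (Nat.choose (n - 1) (k - 1) : ℝ≥0∞) * (Nat.choose (n - 1) (k - 1) : ℝ≥0∞)⁻¹ = 1 :=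
    ENNReal.mul_inv_cancel (by exact_mod_cast hpos.ne') (ENNReal.natCast_ne_top _)
  calc _ = ((ENNReal.ofReal (w k))⁻¹ * ENNReal.ofReal (w k)) *
        ((Nat.choose (n - 1) (k - 1) : ℝ≥0∞) * (Nat.choose (n - 1) (k - 1) : ℝ≥0∞)⁻¹) *
          priorGiven g A s := by rw [e1, e2, one_mul, one_mul]
    _ = _ := by ring

/-- The competitor is `priorGiven g A` with its relevant draws conditioned to short intervals. Each
interval has mass at least `c / n`, so conditioning costs a factor `n / c` per piece. -/
theorem exists_mem_markovClass_near (hn : 0 < n) {B c : ℝ} (hc : 0 < c)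
    (hg1 : ∀ i, ∫⁻ x, ENNReal.ofReal (g i x) = 1) (hgc : ∀ i x, |x| ≤ B + 1 → c ≤ g i x)
    {θs : Fin n → ℝ} (hθB : ∀ i, |θs i| ≤ B) {A : Finset (Fin n)} (hA : ChangesOnlyAt A θs) :
    ∃ Q ∈ markovClass n, (∀ᵐ θ ∂Q, ∀ i, |θ i - θs i| ≤ 1 / n) ∧
      Q ≤ ENNReal.ofReal (n / c) ^ (insert ⟨0, hn⟩ A : Finset (Fin n)).card • priorGiven g A := by
  have hn' : (0 : ℝ) < n := by exact_mod_cast hn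
  have hn1 : (1 : ℝ) / n ≤ 1 := by
    rw [div_le_one hn']
    exact_mod_cast hn
  have hprob := fun i => isProbabilityMeasure_withDensity_ofReal (hg1 i)
  set G : Fin n → Measure ℝ := fun i => volume.withDensity fun x => ENNReal.ofReal (g i x) with hG
  set T : Finset (Fin n) := insert ⟨0, hn⟩ A with hT
  -- Draws outside `T` are discarded by `fill` and stay unconstrained. As `1 / n ≤ 1`, the intervals
  -- lie where `g i ≥ c`.
  set I : Fin n → Set ℝ := fun i => if i ∈ T then Set.Icc (θs i) (θs i + 1 / n) else Set.univ
    with hI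
  have hImeas : ∀ i, MeasurableSet (I i) := by
    intro i
    simp only [hI]
    split_ifs
    · exact measurableSet_Icc
    · exact MeasurableSet.univ
  have hinv : ∀ i, (G i (I i))⁻¹ ≤ if i ∈ T then ENNReal.ofReal (n / c) else 1 := by
    intro i
    simp only [hI]
    split_ifs
    · rw [← inv_inv (ENNReal.ofReal (n / c)), ← ENNReal.ofReal_inv_of_pos (by positivity), inv_div,
        ENNReal.inv_le_inv, hG, withDensity_apply _ measurableSet_Icc]
      calc ENNReal.ofReal (c / n) = ∫⁻ _ in Set.Icc (θs i) (θs i + 1 / n), ENNReal.ofReal c := by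
            rw [setLIntegral_const, Real.volume_Icc, ← ENNReal.ofReal_mul hc.le]
            congr 1
            ring
        _ ≤ _ := by
            refine setLIntegral_mono' measurableSet_Icc fun x hx => ENNReal.ofReal_le_ofReal ?_
            refine hgc i x (abs_le.2 ?_)
            have := abs_le.1 (hθB i)
            exact ⟨by linarith [hx.1], by linarith [hx.2]⟩
    · rw [measure_univ, inv_one]
  have hI0 : ∀ i, G i (I i) ≠ 0 := by
    intro i h0
    have := hinv i
    rw [h0, ENNReal.inv_zero, top_le_iff] at this
    split_ifs at this
    · exact ENNReal.ofReal_ne_top this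
    · exact ENNReal.one_ne_top this
  have hν : ∀ i, IsProbabilityMeasure (cond (G i) (I i)) :=
    fun i => cond_isProbabilityMeasure (hI0 i)
  have hpi : Measure.pi (fun i => cond (G i) (I i)) =
      (∏ i, (G i (I i))⁻¹) • (Measure.pi G).restrict (Set.univ.pi I) := by
    refine Measure.pi_eq fun s _ => ?_
    rw [Measure.smul_apply, Measure.restrict_pi_pi, Measure.pi_pi, smul_eq_mul,
      ← Finset.prod_mul_distrib]
    rfl
  refine ⟨_, map_fill_mem_markovClass hn A (fun i => cond (G i) (I i)), ?_, ?_⟩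
  · refine (ae_map_iff (measurable_fill A).aemeasurable ?_).2 ?_
    · have : {θ : Fin n → ℝ | ∀ i, |θ i - θs i| ≤ 1 / n} =
          ⋂ i, {θ : Fin n → ℝ | |θ i - θs i| ≤ 1 / n} := by ext; simp
      rw [this]
      exact MeasurableSet.iInter fun i => measurableSet_le (by fun_prop) measurable_const
    · rw [hpi]
      refine Measure.ae_smul_measure ?_ _
      filter_upwards [ae_restrict_mem (MeasurableSet.univ_pi hImeas)] with η hη
      refine abs_fill_sub_le hn hA fun j hj => ?_
      have := hη j (Set.mem_univ j)
      simp only [hI, hT, if_pos hj] at this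
      rw [abs_of_nonneg (by linarith [this.1])]
      linarith [this.2]
  · rw [hpi, Measure.map_smul]
    refine Measure.le_iff.2 fun s hs => ?_
    rw [Measure.smul_apply, Measure.smul_apply, smul_eq_mul, smul_eq_mul]
    refine mul_le_mul' ?_ ?_
    · refine (Finset.prod_le_prod' fun i _ => hinv i).trans (le_of_eq ?_)
      rw [Finset.prod_ite_mem, Finset.univ_inter, Finset.prod_const]
    · exact Measure.map_mono Measure.restrict_le_self (measurable_fill A) s

end Prior

/-! ### The likelihood ratio against the true parameter. -/

section Likelihood

variable {n : ℕ}

/-- The log-likelihood ratio of `θ` against `θs` at `x`. -/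
noncomputable def logRatio (σ : ℝ) (x θs θ : Fin n → ℝ) : ℝ :=
  1 / σ ^ 2 * ∑ i, (x i - θs i) * (θ i - θs i) - 1 / (2 * σ ^ 2) * ∑ i, (θ i - θs i) ^ 2

theorem measurable_logRatio (σ : ℝ) (x θs : Fin n → ℝ) : Measurable (logRatio σ x θs) := by
  unfold logRatio
  fun_prop

theorem likelihood_eq_mul {σ : ℝ} (hσ : 0 < σ) (x θs θ : Fin n → ℝ) :
    likelihood σ x θ =
      likelihood σ x θs * ENNReal.ofReal (Real.exp (logRatio σ x θs θ)) := by
  rw [logRatio, Finset.mul_sum, Finset.mul_sum, ← Finset.sum_sub_distrib, ofReal_exp_sum,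
    likelihood, likelihood, ← Finset.prod_mul_distrib]
  refine Finset.prod_congr rfl fun i _ => ?_
  rw [gaussianPDF, gaussianPDF, ← ENNReal.ofReal_mul (gaussianPDFReal_nonneg _ _ _),
    gaussianPDFReal, gaussianPDFReal, mul_assoc _ (Real.exp _) (Real.exp _), ← Real.exp_add, Real.coe_toNNReal _ (sq_nonneg σ)]
  congr 3
  field_simp
  ring

theorem likelihood_ne_zero {σ : ℝ} (hσ : 0 < σ) (x θ : Fin n → ℝ) : likelihood σ x θ ≠ 0 :=
  Finset.prod_ne_zero_iff.2 fun _ _ =>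
    (gaussianPDF_pos _ (by simpa using hσ.ne') _).ne'

theorem likelihood_ne_top (σ : ℝ) (x θ : Fin n → ℝ) : likelihood σ x θ ≠ ∞ :=
  ENNReal.prod_ne_top fun _ _ => gaussianPDF_ne_top

/-- The factor `likelihood σ x θs` is free of `θ` and cancels in the normalization. -/
theorem posterior_eq {σ : ℝ} (hσ : 0 < σ) (P₀ : Measure (Fin n → ℝ)) (x θs : Fin n → ℝ) :
    posterior σ P₀ x = (∫⁻ θ, ENNReal.ofReal (Real.exp (logRatio σ x θs θ)) ∂P₀)⁻¹ •
      P₀.withDensity fun θ => ENNReal.ofReal (Real.exp (logRatio σ x θs θ)) := by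
  have hm : Measurable fun θ => ENNReal.ofReal (Real.exp (logRatio σ x θs θ)) :=
    (Real.measurable_exp.comp (measurable_logRatio σ x θs)).ennreal_ofReal
  have h : likelihood σ x = likelihood σ x θs •
      fun θ => ENNReal.ofReal (Real.exp (logRatio σ x θs θ)) := by
    funext θ
    exact likelihood_eq_mul hσ x θs θ
  have h0 := likelihood_ne_zero hσ x θs
  have htop := likelihood_ne_top σ x θs
  rw [posterior, h, withDensity_smul _ hm, smul_smul]
  congr 1
  simp only [Pi.smul_apply, smul_eq_mul]
  rw [lintegral_const_mul _ hm, ENNReal.mul_inv (Or.inl h0) (Or.inl htop), mul_right_comm,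
    ENNReal.inv_mul_cancel h0 htop, one_mul]

theorem lintegral_exp_logRatio_ne_top {σ : ℝ} (hσ : 0 < σ) (P₀ : Measure (Fin n → ℝ))
    [IsProbabilityMeasure P₀] (x θs : Fin n → ℝ) :
    ∫⁻ θ, ENNReal.ofReal (Real.exp (logRatio σ x θs θ)) ∂P₀ ≠ ∞ := by
  refine ne_top_of_le_ne_top ?_ (lintegral_mono (g := fun _ => ENNReal.ofReal
    (Real.exp (∑ i, (x i - θs i) ^ 2 / (2 * σ ^ 2)))) fun θ => ?_)
  · simp
  · refine ENNReal.ofReal_le_ofReal (Real.exp_le_exp.2 ?_)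
    rw [logRatio, Finset.mul_sum, Finset.mul_sum, ← Finset.sum_sub_distrib]
    refine Finset.sum_le_sum fun i _ => ?_
    have h1 : (x i - θs i) ^ 2 / (2 * σ ^ 2) - (1 / σ ^ 2 * ((x i - θs i) * (θ i - θs i)) -
        1 / (2 * σ ^ 2) * (θ i - θs i) ^ 2) =
        ((x i - θs i) - (θ i - θs i)) ^ 2 / (2 * σ ^ 2) := by
      field_simp
      ring
    have h2 : 0 ≤ ((x i - θs i) - (θ i - θs i)) ^ 2 / (2 * σ ^ 2) := by positivity
    linarith

theorem neg_le_logRatio {σ : ℝ} (hσ : 0 < σ) (hn : 0 < n) (x : Fin n → ℝ) {θs θ : Fin n → ℝ}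
    (h : ∀ i, |θ i - θs i| ≤ 1 / n) :
    -(1 / σ ^ 2 * (1 / n * ∑ i, |x i - θs i|) + 1 / (2 * σ ^ 2)) ≤ logRatio σ x θs θ := by
  have hn' : (1 : ℝ) ≤ n := by exact_mod_cast hn
  have h1 : -(1 / n * ∑ i, |x i - θs i|) ≤ ∑ i, (x i - θs i) * (θ i - θs i) := by
    rw [Finset.mul_sum, ← Finset.sum_neg_distrib]
    refine Finset.sum_le_sum fun i _ => ?_
    have := neg_abs_le ((x i - θs i) * (θ i - θs i))
    rw [abs_mul] at this
    have h2 := mul_le_mul_of_nonneg_left (h i) (abs_nonneg (x i - θs i))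
    linarith
  have h2 : ∑ i, (θ i - θs i) ^ 2 ≤ 1 := by
    calc ∑ i, (θ i - θs i) ^ 2 ≤ ∑ _i : Fin n, (1 / n : ℝ) := by
          refine Finset.sum_le_sum fun i _ => ?_
          rw [← sq_abs]
          have h3 : (1 : ℝ) / n ≤ 1 := by rw [div_le_one (by linarith)]; exact hn'
          nlinarith [h i, abs_nonneg (θ i - θs i)]
      _ = 1 := by
          rw [Finset.sum_const, Finset.card_univ, Fintype.card_fin, nsmul_eq_mul]
          field_simp
  have h3 := mul_le_mul_of_nonneg_left h1 (by positivity : (0 : ℝ) ≤ 1 / σ ^ 2)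
  have h4 := mul_le_mul_of_nonneg_left h2 (by positivity : (0 : ℝ) ≤ 1 / (2 * σ ^ 2))
  rw [logRatio]
  linarith

end Likelihood

/-! ### Fractional moment of the tilted evidence. -/

section Evidence

theorem sum_rpow_le_sum_rpow {ι : Type*} (t : Finset ι) (f : ι → ℝ≥0∞) {s : ℝ} (hs0 : 0 < s)
    (hs1 : s ≤ 1) : (∑ i ∈ t, f i) ^ s ≤ ∑ i ∈ t, f i ^ s := by
  classical
  induction t using Finset.induction_on with
  | empty => simp [ENNReal.zero_rpow_of_pos hs0]
  | insert i t hi ih =>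
    rw [Finset.sum_insert hi, Finset.sum_insert hi]
    exact (ENNReal.rpow_add_le_add_rpow _ _ hs0.le hs1).trans (by gcongr)

theorem lintegral_abs_sub_gaussianReal_le (m : ℝ) (v : ℝ≥0) :
    ∫⁻ x, ENNReal.ofReal |x - m| ∂gaussianReal m v ≤ ENNReal.ofReal (2 * Real.exp (v / 2)) := by
  calc ∫⁻ x, ENNReal.ofReal |x - m| ∂gaussianReal m v
      ≤ ∫⁻ x, (ENNReal.ofReal (Real.exp (1 * (x - m))) +
          ENNReal.ofReal (Real.exp (-1 * (x - m)))) ∂gaussianReal m v := by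
        refine lintegral_mono fun x => ?_
        rw [← ENNReal.ofReal_add (Real.exp_nonneg _) (Real.exp_nonneg _)]
        refine ENNReal.ofReal_le_ofReal (abs_le.2 ⟨?_, ?_⟩)
        · linarith [Real.add_one_le_exp (-1 * (x - m)), Real.exp_pos (1 * (x - m))]
        · linarith [Real.add_one_le_exp (1 * (x - m)), Real.exp_pos (-1 * (x - m))]
    _ = _ := by
        rw [lintegral_add_left (by fun_prop), lintegral_exp_mul_sub_gaussianReal,
          lintegral_exp_mul_sub_gaussianReal,
          ← ENNReal.ofReal_add (Real.exp_nonneg _) (Real.exp_nonneg _)]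
        congr 1
        norm_num
        ring

variable {n : ℕ}

instance (σ : ℝ) (θ : Fin n → ℝ) : IsProbabilityMeasure (model σ θ) := by
  unfold model
  infer_instance

theorem lintegral_mean_abs_sub_model_le (hn : 0 < n) (σ : ℝ) (θs : Fin n → ℝ) {a : ℝ}
    (ha : 0 ≤ a) :
    ∫⁻ x, ENNReal.ofReal (a * (1 / n * ∑ i, |x i - θs i|)) ∂model σ θs ≤
      ENNReal.ofReal (a * (2 * Real.exp (σ ^ 2 / 2))) := by
  have hn' : (0 : ℝ) < n := by exact_mod_cast hn
  have h : ∀ x : Fin n → ℝ, ENNReal.ofReal (a * (1 / n * ∑ i, |x i - θs i|)) =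
      ENNReal.ofReal (a * (1 / n)) * ∑ i, ENNReal.ofReal |x i - θs i| := by
    intro x
    rw [← ENNReal.ofReal_sum_of_nonneg fun _ _ => abs_nonneg _,
      ← ENNReal.ofReal_mul (by positivity), mul_assoc]
  simp_rw [h]
  rw [lintegral_const_mul _ (by fun_prop), lintegral_finsetSum _ (fun i _ => by fun_prop)]
  have h2 : ∀ i, ∫⁻ x, ENNReal.ofReal |x i - θs i| ∂model σ θs ≤
      ENNReal.ofReal (2 * Real.exp (σ ^ 2 / 2)) := by
    intro i
    have h3 := (measurePreserving_eval (fun i => gaussianReal (θs i) (σ ^ 2).toNNReal)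
      i).lintegral_comp (f := fun y => ENNReal.ofReal |y - θs i|) (by fun_prop)
    refine (le_of_eq h3).trans ?_
    have h4 := lintegral_abs_sub_gaussianReal_le (θs i) (σ ^ 2).toNNReal
    rwa [Real.coe_toNNReal _ (sq_nonneg σ)] at h4
  calc _ ≤ ENNReal.ofReal (a * (1 / n)) *
        ∑ _i : Fin n, ENNReal.ofReal (2 * Real.exp (σ ^ 2 / 2)) := by
        gcongr with i
        exact h2 i
    _ = _ := by
        rw [Finset.sum_const, Finset.card_univ, Fintype.card_fin, nsmul_eq_mul,
          ← ENNReal.ofReal_natCast, ← ENNReal.ofReal_mul hn'.le,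
          ← ENNReal.ofReal_mul (by positivity)]
        congr 1
        field_simp

/-- The tilt leaves a share `r` of the quadratic term, so the exponent is at most `1 / (2 r σ²)`
times the squared projection of the noise. The power `r ^ 2` turns this into `r / (2 σ²)`, that is,
the chi-square moment at `r / 2`, which is finite for `r < 1`. -/
theorem exists_evidence_bound {σ : ℝ} (hσ : 0 < σ) (hn : 0 < n) {k : ℕ} (hk : 1 ≤ k)
    {r : ℝ} (hr0 : 0 < r) (hr1 : r ≤ 1) (w : ℕ → ℝ) {g : Fin n → ℝ → ℝ}
    (hg1 : ∀ i, ∫⁻ x, ENNReal.ofReal (g i x) = 1) {θs : Fin n → ℝ} {A₀ : Finset (Fin n)}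
    (hA₀ : A₀.card ≤ k - 1) (hθs : ChangesOnlyAt A₀ θs) :
    ∃ U : (Fin n → ℝ) → ℝ≥0∞, Measurable U ∧ (∀ x, U x ≠ ∞) ∧
      (∀ x, (∫⁻ θ, ENNReal.ofReal (Real.exp ((1 - r) / (2 * σ ^ 2) * ∑ i, (θ i - θs i) ^ 2)) *
        ENNReal.ofReal (Real.exp (logRatio σ x θs θ)) ∂prior w g) ^ (r ^ 2) ≤ U x) ∧
      ∫⁻ x, U x ∂model σ θs ≤ ∑ l ∈ Finset.Icc 1 n, (Nat.choose (n - 1) (l - 1) : ℝ≥0∞) *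
        ((ENNReal.ofReal (w l) * (Nat.choose (n - 1) (l - 1) : ℝ≥0∞)⁻¹) ^ (r ^ 2) *
          gaussianSqMgf (r / 2) ^ (l + k)) := by
  have hs0 : 0 < r ^ 2 := by positivity
  have hs1 : r ^ 2 ≤ 1 := pow_le_one₀ hr0.le hr1
  choose b hb using fun A : Finset (Fin n) => exists_label hn (A ∪ A₀)
  set ρ : ℝ := r / (2 * σ ^ 2) with hρ
  set F : Finset (Fin n) → (Fin n → ℝ) → ℝ≥0∞ := fun A x =>
    ENNReal.ofReal (Real.exp (ρ * fiberSq (b A) fun i => x i - θs i)) with hF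
  have hFm : ∀ A, Measurable (F A) := by
    intro A
    have : Measurable fun x : Fin n → ℝ => fiberSq (b A) fun i => x i - θs i :=
      (measurable_fiberSq (b A)).comp (by fun_prop)
    exact (Real.measurable_exp.comp (this.const_mul ρ)).ennreal_ofReal
  set wt : ℕ → ℝ≥0∞ := fun l => ENNReal.ofReal (w l) * (Nat.choose (n - 1) (l - 1) : ℝ≥0∞)⁻¹
    with hwt
  have hwt_top : ∀ l ∈ Finset.Icc 1 n, wt l ≠ ∞ := by
    intro l hl
    refine ENNReal.mul_ne_top ENNReal.ofReal_ne_top (ENNReal.inv_ne_top.2 ?_)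
    exact_mod_cast (Nat.choose_pos (Nat.sub_le_sub_right (Finset.mem_Icc.1 hl).2 1)).ne'
  refine ⟨fun x => ∑ l ∈ Finset.Icc 1 n, ∑ A ∈ Finset.powersetCard (l - 1)
      (Finset.univ.filter fun i : Fin n => (i : ℕ) ≠ 0), wt l ^ (r ^ 2) * F A x,
    by fun_prop, fun x => ?_, fun x => ?_, ?_⟩
  · refine ENNReal.sum_ne_top.2 fun l hl => ENNReal.sum_ne_top.2 fun A _ => ?_
    exact ENNReal.mul_ne_top (ENNReal.rpow_ne_top_of_nonneg hs0.le (hwt_top l hl))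
      ENNReal.ofReal_ne_top
  · rw [lintegral_prior]
    refine (sum_rpow_le_sum_rpow _ _ hs0 hs1).trans (Finset.sum_le_sum fun l _ => ?_)
    refine (sum_rpow_le_sum_rpow _ _ hs0 hs1).trans (Finset.sum_le_sum fun A _ => ?_)
    rw [ENNReal.mul_rpow_of_nonneg _ _ hs0.le]
    refine mul_le_mul_right ?_ _
    have hprob := isProbabilityMeasure_priorGiven hg1 A
    have hbound : ∫⁻ θ, ENNReal.ofReal (Real.exp ((1 - r) / (2 * σ ^ 2) *
          ∑ i, (θ i - θs i) ^ 2)) * ENNReal.ofReal (Real.exp (logRatio σ x θs θ)) ∂priorGiven g A ≤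
        ENNReal.ofReal (Real.exp (1 / (2 * r * σ ^ 2) * fiberSq (b A) fun i => x i - θs i)) := by
      have hm : Measurable fun θ => ENNReal.ofReal (Real.exp ((1 - r) / (2 * σ ^ 2) *
          ∑ i, (θ i - θs i) ^ 2)) * ENNReal.ofReal (Real.exp (logRatio σ x θs θ)) :=
        Measurable.mul (by fun_prop)
          (Real.measurable_exp.comp (measurable_logRatio σ x θs)).ennreal_ofReal
      rw [priorGiven, lintegral_map hm (measurable_fill A)]
      have hprob' := fun i => isProbabilityMeasure_withDensity_ofReal (hg1 i)
      refine (lintegral_mono (g := fun _ => ENNReal.ofReal (Real.exp (1 / (2 * r * σ ^ 2) *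
        fiberSq (b A) fun i => x i - θs i))) fun η => ?_).trans (le_of_eq (by simp))
      simp only
      rw [← ENNReal.ofReal_mul (Real.exp_nonneg _), ← Real.exp_add]
      refine ENNReal.ofReal_le_ofReal (Real.exp_le_exp.2 ?_)
      -- The difference can jump where either vector does, so the projection is on the common
      -- refinement.
      have hδ : ChangesOnlyAt (A ∪ A₀) fun i => fill A η i - θs i :=
        ((changesOnlyAt_fill A η).mono Finset.subset_union_left).sub
          (hθs.mono Finset.subset_union_right)
      have h := sum_sub_sq_le_fiberSq (b A) (fun i => x i - θs i) (fun i => fill A η i - θs i)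
        (fun j => fill A η j - θs j) (hb A _ hδ) (p := 1 / σ ^ 2) (q := ρ) (by positivity)
      have e : (1 / σ ^ 2) ^ 2 / (4 * ρ) = 1 / (2 * r * σ ^ 2) := by
        rw [hρ]
        field_simp
        norm_num
      rw [e] at h
      refine le_trans (le_of_eq ?_) h
      rw [logRatio, hρ]
      ring
    refine (ENNReal.rpow_le_rpow hbound hs0.le).trans (le_of_eq ?_)
    rw [ENNReal.ofReal_rpow_of_pos (Real.exp_pos _), ← Real.exp_mul, hF]
    simp only
    congr 2
    rw [hρ]
    field_simp
  · rw [lintegral_finsetSum _ (fun l _ => by fun_prop)]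
    refine Finset.sum_le_sum fun l hl => ?_
    rw [lintegral_finsetSum _ (fun A _ => by fun_prop)]
    have hA : ∀ A ∈ Finset.powersetCard (l - 1)
        (Finset.univ.filter fun i : Fin n => (i : ℕ) ≠ 0),
        ∫⁻ x, wt l ^ (r ^ 2) * F A x ∂model σ θs ≤
          wt l ^ (r ^ 2) * gaussianSqMgf (r / 2) ^ (l + k) := by
      intro A hA
      rw [lintegral_const_mul _ (hFm A)]
      refine mul_le_mul_right ?_ _
      have h := lintegral_exp_fiberSq_le (b A) θs (σ ^ 2).toNNReal (t := ρ) (by positivity)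
      have e : ((σ ^ 2).toNNReal : ℝ) * ρ = r / 2 := by
        rw [Real.coe_toNNReal _ (sq_nonneg σ), hρ]
        field_simp
      rw [e, Fintype.card_coe] at h
      -- There are at most `(l - 1) + (k - 1) + 1` labels.
      refine h.trans (pow_le_pow_right₀ (one_le_gaussianSqMgf (by positivity)) ?_)
      have h1 := Finset.card_insert_le (⟨0, hn⟩ : Fin n) (A ∪ A₀)
      have h2 := Finset.card_union_le A A₀
      have h3 := (Finset.mem_powersetCard.1 hA).2
      have h4 := (Finset.mem_Icc.1 hl).1
      omega
    refine (Finset.sum_le_sum hA).trans (le_of_eq ?_)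
    rw [Finset.sum_const, Finset.card_powersetCard, card_filter_ne_zero hn, nsmul_eq_mul]

end Evidence

/-! ### Numerical bounds. -/

section Constants

/-- The power `s = 2 / (2 + C₂)` satisfies `s < 1` and `C₂ s - (1 - s) = C₂ / (2 + C₂) > 0`, so the
prior decay outweighs the count `m ^ (1 - s)` and leaves `n ^ (-ε l)` against `K ^ l`. -/
theorem exists_weight_bound {C₁ C₂ K : ℝ} (hC₁ : 0 < C₁) (hC₂ : 0 < C₂) (hK : 1 ≤ K) :
    ∃ D : ℝ, 1 ≤ D ∧ ∀ n l m : ℕ, 2 ≤ n → 1 ≤ l → l ≤ n → 1 ≤ m → m ≤ n ^ (l - 1) →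
      ∀ w : ℝ, 0 ≤ w → w ≤ 1 → (2 ≤ l → w ≤ C₁ * (n : ℝ) ^ (-(C₂ * (l : ℝ)))) →
        (m : ℝ) * (w * (m : ℝ)⁻¹) ^ (2 / (2 + C₂)) * K ^ l ≤ D := by
  set s := 2 / (2 + C₂) with hs
  have hs0 : 0 < s := by positivity
  have hs1 : s ≤ 1 := by rw [hs, div_le_one (by positivity)]; linarith
  set ε := C₂ / (2 + C₂) with hε
  have hε0 : 0 < ε := by positivity
  have hK0 : 0 < K := by linarith
  refine ⟨K + C₁ ^ s * K ^ (K ^ (1 / ε)), ?_, ?_⟩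
  · have : 0 ≤ C₁ ^ s * K ^ (K ^ (1 / ε)) := by positivity
    linarith
  intro n l m hn hl hln hm hmn w hw0 hw1 hw
  have hn0 : (0 : ℝ) < n := by exact_mod_cast (by omega : 0 < n)
  have hm0 : (0 : ℝ) < m := by exact_mod_cast hm
  rcases hl.eq_or_lt with rfl | hl2
  · have hm1 : m = 1 := le_antisymm (by simpa using hmn) hm
    subst hm1
    have h1 : w ^ s ≤ 1 := Real.rpow_le_one hw0 hw1 hs0.le
    have h2 : 0 ≤ C₁ ^ s * K ^ (K ^ (1 / ε)) := by positivity
    simp only [Nat.cast_one, inv_one, mul_one, one_mul, pow_one]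
    nlinarith
  · have hmn' : (m : ℝ) ≤ (n : ℝ) ^ (l : ℝ) := by
      rw [Real.rpow_natCast]
      refine (Nat.cast_le.2 hmn).trans ?_
      push_cast
      exact pow_le_pow_right₀ (by exact_mod_cast (by omega : 1 ≤ n)) (by omega)
    have h1 : (m : ℝ) * (w * (m : ℝ)⁻¹) ^ s = w ^ s * (m : ℝ) ^ (1 - s) := by
      rw [Real.mul_rpow hw0 (by positivity), Real.inv_rpow hm0.le, Real.rpow_sub hm0,
        Real.rpow_one]
      field_simp
    have h2 : w ^ s ≤ C₁ ^ s * (n : ℝ) ^ (-(C₂ * (l : ℝ)) * s) := by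
      rw [Real.rpow_mul hn0.le, ← Real.mul_rpow hC₁.le (by positivity)]
      exact Real.rpow_le_rpow hw0 (hw hl2) hs0.le
    have h3 : (m : ℝ) ^ (1 - s) ≤ (n : ℝ) ^ ((l : ℝ) * (1 - s)) := by
      rw [Real.rpow_mul hn0.le]
      exact Real.rpow_le_rpow hm0.le hmn' (by linarith)
    have h4 : w ^ s * (m : ℝ) ^ (1 - s) ≤ C₁ ^ s * (n : ℝ) ^ (-ε * (l : ℝ)) := by
      refine (mul_le_mul h2 h3 (by positivity) (by positivity)).trans (le_of_eq ?_)
      rw [mul_assoc, ← Real.rpow_add hn0]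
      congr 2
      rw [hs, hε]
      field_simp
      ring
    have h5 : (n : ℝ) ^ (-ε * (l : ℝ)) * K ^ l ≤ K ^ (K ^ (1 / ε)) := by
      -- Either `n ^ (-ε)` absorbs each factor `K`, or `n`, and with it `l ≤ n`, is bounded by `K ^
      -- (1 / ε)`.
      rcases le_or_gt K ((n : ℝ) ^ ε) with hcase | hcase
      · refine le_trans ?_ (Real.one_le_rpow hK (by positivity))
        rw [Real.rpow_mul hn0.le, Real.rpow_natCast, ← mul_pow, Real.rpow_neg hn0.le]
        refine pow_le_one₀ (by positivity) ?_
        rw [inv_mul_le_one₀ (by positivity)]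
        exact hcase
      · have h6 : (n : ℝ) ≤ K ^ (1 / ε) := by
          have := Real.rpow_le_rpow (by positivity) hcase.le (by positivity : 0 ≤ 1 / ε)
          rwa [← Real.rpow_mul hn0.le, mul_one_div_cancel hε0.ne', Real.rpow_one] at this
        have h7 : (n : ℝ) ^ (-ε * (l : ℝ)) ≤ 1 := by
          refine Real.rpow_le_one_of_one_le_of_nonpos (by exact_mod_cast (by omega : 1 ≤ n)) ?_
          have : 0 ≤ ε * (l : ℝ) := by positivity
          linarith
        have h8 : K ^ l ≤ K ^ (K ^ (1 / ε)) := by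
          rw [← Real.rpow_natCast]
          refine Real.rpow_le_rpow_of_exponent_le hK (le_trans ?_ h6)
          exact_mod_cast hln
        calc _ ≤ 1 * K ^ l := by gcongr
          _ ≤ _ := by rw [one_mul]; exact h8
    calc (m : ℝ) * (w * (m : ℝ)⁻¹) ^ s * K ^ l
        ≤ C₁ ^ s * (n : ℝ) ^ (-ε * (l : ℝ)) * K ^ l := by
          rw [h1]
          gcongr
      _ = C₁ ^ s * ((n : ℝ) ^ (-ε * (l : ℝ)) * K ^ l) := by ring
      _ ≤ C₁ ^ s * K ^ (K ^ (1 / ε)) := by gcongr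
      _ ≤ _ := by linarith

/-- The tangent of `log` at `E`, playing the role of Jensen: the bound is linear in `z`, so it can
be averaged over the observation directly. -/
theorem log_le_div_add_log {z E : ℝ} (hz : 0 < z) (hE : 0 < E) :
    Real.log z ≤ z / E - 1 + Real.log E := by
  have h := Real.log_le_sub_one_of_pos (div_pos hz hE)
  rw [Real.log_div hz.ne' hE.ne'] at h
  linarith

end Constants

/-! ### From one observation to the risk. -/

section Risk

variable {n : ℕ}

theorem lintegral_sq_le_of_isVariationalPosterior {σ : ℝ} (hσ : 0 < σ) (hn : 0 < n)
    {P₀ Q Q' : Measure (Fin n → ℝ)} [IsProbabilityMeasure P₀] {x θs : Fin n → ℝ}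
    (hQ' : IsVariationalPosterior (markovClass n) (posterior σ P₀ x) Q')
    (hQ : Q ∈ markovClass n) (hQθs : ∀ᵐ θ ∂Q, ∀ i, |θ i - θs i| ≤ 1 / n) {R : ℝ} (hR : 0 < R)
    (hQR : Q ≤ ENNReal.ofReal R • P₀) {a s E : ℝ} (ha : 0 ≤ a) (hs : 0 < s) (hE : 1 ≤ E)
    {U : ℝ≥0∞} (hU : U ≠ ∞)
    (hUs : (∫⁻ θ, ENNReal.ofReal (Real.exp (a * ∑ i, (θ i - θs i) ^ 2)) *
        ENNReal.ofReal (Real.exp (logRatio σ x θs θ)) ∂P₀) ^ s ≤ U) :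
    ∫⁻ θ, ENNReal.ofReal (a * ∑ i, (θ i - θs i) ^ 2) ∂Q' ≤
      ENNReal.ofReal (Real.log R + 1 / (2 * σ ^ 2) + (Real.log E + 1) / s) +
        ENNReal.ofReal (1 / σ ^ 2 * (1 / n * ∑ i, |x i - θs i|)) +
        ENNReal.ofReal (1 / (s * E)) * U := by
  have hQprob := isProbabilityMeasure_of_mem_markovClass hQ
  have hQ'prob := isProbabilityMeasure_of_mem_markovClass hQ'.1
  have hu0 : 0 ≤ U.toReal := ENNReal.toReal_nonneg
  set u := U.toReal with hu
  have hUu : U = ENNReal.ofReal u := (ENNReal.ofReal_toReal hU).symm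
  -- The added `1` keeps the logarithm meaningful when `u = 0`; it costs at most `1 / s` since `E ≥
  -- 1`.
  have hy : 0 < (u + 1) ^ (1 / s) := Real.rpow_pos_of_pos (by linarith) _
  have h := lintegral_le_of_klDiv_le P₀ Q Q' (measurable_logRatio σ x θs)
    (f := fun θ => a * ∑ i, (θ i - θs i) ^ 2) (by fun_prop) (fun θ => by positivity) hR hy
    (lintegral_exp_logRatio_ne_top hσ P₀ x θs) hQR
    (hQθs.mono fun θ hθ => neg_le_logRatio hσ hn x hθ) ?_ ?_
  · refine h.trans ?_
    have hlog : Real.log ((u + 1) ^ (1 / s)) ≤ (Real.log E + 1) / s + 1 / (s * E) * u := by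
      rw [Real.log_rpow (by linarith)]
      have h1 := log_le_div_add_log (z := u + 1) (E := E) (by linarith) (by linarith)
      have h2 : (u + 1) / E - 1 ≤ u / E := by
        have : 1 / E ≤ 1 := (div_le_one (by linarith)).2 hE
        rw [add_div]
        linarith
      calc 1 / s * Real.log (u + 1) ≤ 1 / s * (u / E + Real.log E + 1) := by
            gcongr
            linarith
        _ = _ := by
            field_simp
            ring
    rw [hUu, ← ENNReal.ofReal_mul (by positivity)]
    refine le_trans (ENNReal.ofReal_le_ofReal ?_)
      (ENNReal.ofReal_add_le.trans (add_le_add_left ENNReal.ofReal_add_le _))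
    linarith
  · have h1 := ENNReal.rpow_le_rpow hUs (by positivity : 0 ≤ 1 / s)
    rw [← ENNReal.rpow_mul, mul_one_div_cancel hs.ne', ENNReal.rpow_one, hUu,
      ENNReal.ofReal_rpow_of_nonneg hu0 (by positivity)] at h1
    refine h1.trans (ENNReal.ofReal_le_ofReal ?_)
    exact Real.rpow_le_rpow hu0 (by linarith) (by positivity)
  · intro P hP
    rw [← posterior_eq hσ P₀ x θs] at hP
    rw [hP]
    exact hQ'.2 hQ

theorem lintegral_risk_le {σ : ℝ} (hσ : 0 < σ) (hn : 0 < n) {P₀ Q : Measure (Fin n → ℝ)}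
    [IsProbabilityMeasure P₀] {θs : Fin n → ℝ} {Q' : (Fin n → ℝ) → Measure (Fin n → ℝ)}
    (hQ' : ∀ᵐ x ∂model σ θs, IsVariationalPosterior (markovClass n) (posterior σ P₀ x) (Q' x))
    (hQ : Q ∈ markovClass n) (hQθs : ∀ᵐ θ ∂Q, ∀ i, |θ i - θs i| ≤ 1 / n) {R : ℝ} (hR : 0 < R)
    (hQR : Q ≤ ENNReal.ofReal R • P₀) {a s E : ℝ} (ha : 0 < a) (hs : 0 < s) (hE : 1 ≤ E)
    {U : (Fin n → ℝ) → ℝ≥0∞} (hUm : Measurable U) (hU : ∀ x, U x ≠ ∞)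
    (hUs : ∀ x, (∫⁻ θ, ENNReal.ofReal (Real.exp (a * ∑ i, (θ i - θs i) ^ 2)) *
        ENNReal.ofReal (Real.exp (logRatio σ x θs θ)) ∂P₀) ^ s ≤ U x)
    (hUE : ∫⁻ x, U x ∂model σ θs ≤ ENNReal.ofReal E) {H : ℝ}
    (hH : Real.log R + 1 / (2 * σ ^ 2) + (Real.log E + 1) / s ≤ H) (hH0 : 0 ≤ H) :
    ∫⁻ x, ∫⁻ θ, ENNReal.ofReal (∑ i, (θ i - θs i) ^ 2) ∂(Q' x) ∂model σ θs ≤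
      ENNReal.ofReal ((H + 1 / σ ^ 2 * (2 * Real.exp (σ ^ 2 / 2)) + 1 / s) / a) := by
  have ha0 : ENNReal.ofReal a ≠ 0 := by simpa using ha
  have h1 : ENNReal.ofReal a * ∫⁻ x, ∫⁻ θ, ENNReal.ofReal (∑ i, (θ i - θs i) ^ 2) ∂(Q' x)
      ∂model σ θs ≤ ENNReal.ofReal (H + 1 / σ ^ 2 * (2 * Real.exp (σ ^ 2 / 2)) + 1 / s) := by
    rw [← lintegral_const_mul' _ _ ENNReal.ofReal_ne_top]
    calc _ ≤ ∫⁻ x, (ENNReal.ofReal H +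
          ENNReal.ofReal (1 / σ ^ 2 * (1 / n * ∑ i, |x i - θs i|)) +
          ENNReal.ofReal (1 / (s * E)) * U x) ∂model σ θs := by
          refine lintegral_mono_ae ?_
          filter_upwards [hQ'] with x hx
          rw [← lintegral_const_mul' _ _ ENNReal.ofReal_ne_top]
          simp_rw [← ENNReal.ofReal_mul ha.le]
          refine (lintegral_sq_le_of_isVariationalPosterior hσ hn hx hQ hQθs hR hQR ha.le hs hE
            (hU x) (hUs x)).trans ?_
          gcongr
      _ ≤ ENNReal.ofReal H + ENNReal.ofReal (1 / σ ^ 2 * (2 * Real.exp (σ ^ 2 / 2))) +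
          ENNReal.ofReal (1 / s) := by
          rw [lintegral_add_right _ (hUm.const_mul _), lintegral_add_left measurable_const,
            lintegral_const, measure_univ, mul_one, lintegral_const_mul _ hUm]
          refine add_le_add (add_le_add le_rfl
            (lintegral_mean_abs_sub_model_le hn σ θs (by positivity))) ?_
          refine (mul_le_mul_right hUE _).trans (le_of_eq ?_)
          rw [← ENNReal.ofReal_mul (by positivity)]
          congr 1
          field_simp
      _ = _ := by
          rw [← ENNReal.ofReal_add hH0 (by positivity),
            ← ENNReal.ofReal_add (by positivity) (by positivity)]
  rw [div_eq_inv_mul, ENNReal.ofReal_mul (by positivity), ENNReal.ofReal_inv_of_pos ha]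
  calc _ = (ENNReal.ofReal a)⁻¹ * (ENNReal.ofReal a * ∫⁻ x, ∫⁻ θ,
        ENNReal.ofReal (∑ i, (θ i - θs i) ^ 2) ∂(Q' x) ∂model σ θs) := by
        rw [← mul_assoc, ENNReal.inv_mul_cancel ha0 ENNReal.ofReal_ne_top, one_mul]
    _ ≤ _ := mul_le_mul_right h1 _

end Risk

end PiecewiseConstant

/-! ### The main theorem: choice of constants and assembly. -/

open PiecewiseConstant in
set_option maxHeartbeats 1000000 in
theorem mainTheorem6 (σ B C₁ C₂ C₃ C₄ c : ℝ) (hσ : 0 < σ) (hB : 0 < B)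
    (hC₁ : 0 < C₁) (hC₂ : 0 < C₂) (hC₃ : 0 < C₃) (hC₄ : 0 < C₄) (hc : 0 < c) :
    ∃ M : ℝ, 0 < M ∧ ∀ n k : ℕ, 2 ≤ n → 1 ≤ k → k ≤ n →
      ∀ w : ℕ → ℝ, (∀ j ∈ Finset.Icc 1 n, 0 ≤ w j) → ∑ j ∈ Finset.Icc 1 n, w j = 1 →
      (∀ l : ℕ, 2 ≤ l → ∑ j ∈ Finset.Icc l n, w j ≤ C₁ * (n : ℝ) ^ (-(C₂ * (l : ℝ)))) →
      C₃ * (n : ℝ) ^ (-(C₄ * (k : ℝ))) ≤ w k →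
      ∀ g : Fin n → ℝ → ℝ, (∀ i, Measurable (g i)) → (∀ i x, 0 ≤ g i x) →
      (∀ i, ∫⁻ x, ENNReal.ofReal (g i x) = 1) →
      (∀ i x, |x| ≤ B + 1 → c ≤ g i x) →
      ∀ θs ∈ PiecewiseConstant.boundedPieceClass n k B,
      ∀ Qhat : Kernel (Fin n → ℝ) (Fin n → ℝ),
      (∀ᵐ x ∂(PiecewiseConstant.model σ θs),
        PiecewiseConstant.IsVariationalPosterior (PiecewiseConstant.markovClass n)
          (PiecewiseConstant.posterior σ (PiecewiseConstant.prior w g) x) (Qhat x)) →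
      ∫⁻ x, ∫⁻ θ, ENNReal.ofReal (∑ i, (θ i - θs i) ^ 2) ∂(Qhat x)
          ∂(PiecewiseConstant.model σ θs)
        ≤ ENNReal.ofReal (M * ((k : ℝ) * Real.log (n : ℝ))) := by
  set s := 2 / (2 + C₂) with hs
  have hs0 : 0 < s := by positivity
  have hs1 : s < 1 := by rw [hs, div_lt_one (by positivity)]; linarith
  -- The evidence bound uses the power `r ^ 2` and the weight bound the power `s`.
  set r := √s with hr
  have hr0 : 0 < r := Real.sqrt_pos.2 hs0
  have hrs : r ^ 2 = s := Real.sq_sqrt hs0.le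
  have hr1 : r < 1 := by nlinarith
  set a := (1 - r) / (2 * σ ^ 2) with ha
  have ha0 : 0 < a := div_pos (by linarith) (by positivity)
  have hKtop : gaussianSqMgf (r / 2) < ∞ := gaussianSqMgf_lt_top (by linarith)
  set K := (gaussianSqMgf (r / 2)).toReal with hK
  have hKK : gaussianSqMgf (r / 2) = ENNReal.ofReal K := (ENNReal.ofReal_toReal hKtop.ne).symm
  have hK1 : 1 ≤ K := by
    have := one_le_gaussianSqMgf (c := r / 2) (by positivity)
    rwa [hKK, ENNReal.one_le_ofReal] at this
  obtain ⟨D, hD1, hD⟩ := exists_weight_bound hC₁ hC₂ hK1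
  have hlogD : 0 ≤ Real.log D := Real.log_nonneg hD1
  have hlogK : 0 ≤ Real.log K := Real.log_nonneg hK1
  have hlog2 : 0 < Real.log 2 := Real.log_pos one_lt_two
  set J := |Real.log c| + |Real.log C₃| + 1 / (2 * σ ^ 2) + (Real.log D + Real.log K + 1) / s with hJ
  have hJ0 : 0 ≤ J := by positivity
  set J' := 1 / σ ^ 2 * (2 * Real.exp (σ ^ 2 / 2)) + 1 / s with hJ'
  have hJ'0 : 0 < J' := by positivity
  -- Of `2 + C₄ + 1 / s`, one unit each comes from the interval masses and the number of sets `A`,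
  -- `C₄` from (MC2), and `1 / s` from `log E`. The constants `J`, `J'` are absorbed through `k ≤ k
  -- log n / log 2`.
  refine ⟨(2 + C₄ + 1 / s + (J + J') / Real.log 2) / a, by positivity, ?_⟩
  intro n k hn hk hkn w hw hw1 hwl hwk g _ _ hg1 hgc θs hθs Qhat hQhat
  have hn0 : 0 < n := by omega
  have hnR : (2 : ℝ) ≤ n := by exact_mod_cast hn
  have hnR0 : (0 : ℝ) < n := by linarith
  have hkR : (1 : ℝ) ≤ k := by exact_mod_cast hk
  have hwkpos : 0 < w k := lt_of_lt_of_le (by positivity) hwk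
  have hprior := isProbabilityMeasure_prior hn0 hw hw1 hg1
  obtain ⟨A, hA, hAθ⟩ := exists_changesOnlyAt_of_mem_pieceClass hk hkn hθs.1
  obtain ⟨Q, hQ, hQθ, hQle⟩ := exists_mem_markovClass_near hn0 hc hg1 hgc hθs.2 hAθ
  have hAcard := (Finset.mem_powersetCard.1 hA).2
  have h0A : (⟨0, hn0⟩ : Fin n) ∉ A := fun h =>
    (Finset.mem_filter.1 ((Finset.mem_powersetCard.1 hA).1 h)).2 rfl
  rw [Finset.card_insert_of_notMem h0A, hAcard, Nat.sub_add_cancel hk,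
    ← ENNReal.ofReal_pow (by positivity)] at hQle
  set C := Nat.choose (n - 1) (k - 1) with hC
  have hCpos : 0 < C := Nat.choose_pos (Nat.sub_le_sub_right hkn 1)
  have hchoose : ∀ l, Nat.choose (n - 1) (l - 1) ≤ n ^ (l - 1) := fun l =>
    (Nat.choose_le_pow _ _).trans (Nat.pow_le_pow_left (Nat.sub_le n 1) _)
  set R : ℝ := (n / c) ^ k * ((w k)⁻¹ * C) with hR
  have hCR : (0 : ℝ) < C := by exact_mod_cast hCpos
  have hR0 : 0 < R := by positivity
  have hQR : Q ≤ ENNReal.ofReal R • prior w g := by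
    rw [hR, ENNReal.ofReal_mul (by positivity), mul_smul]
    refine hQle.trans (Measure.le_iff.2 fun t _ => ?_)
    rw [Measure.smul_apply, Measure.smul_apply, smul_eq_mul, smul_eq_mul]
    exact mul_le_mul_right (priorGiven_le_smul_prior hk hkn hwkpos hA t) _
  obtain ⟨U, hUm, hUtop, hUs, hUint⟩ := exists_evidence_bound hσ hn0 hk hr0 hr1.le w hg1
    hAcard.le hAθ
  rw [hrs] at hUs hUint
  set E : ℝ := n * D * K ^ k with hE
  have hKk : 1 ≤ K ^ k := one_le_pow₀ hK1
  have hE1 : 1 ≤ E := by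
    exact one_le_mul_of_one_le_of_one_le
      (one_le_mul_of_one_le_of_one_le (by linarith) hD1) hKk
  have hUE : ∫⁻ x, U x ∂model σ θs ≤ ENNReal.ofReal E := by
    refine hUint.trans ?_
    have hterm : ∀ l ∈ Finset.Icc 1 n, (Nat.choose (n - 1) (l - 1) : ℝ≥0∞) *
        ((ENNReal.ofReal (w l) * (Nat.choose (n - 1) (l - 1) : ℝ≥0∞)⁻¹) ^ s *
          gaussianSqMgf (r / 2) ^ (l + k)) ≤ ENNReal.ofReal (D * K ^ k) := by
      intro l hl
      obtain ⟨hl1, hln⟩ := Finset.mem_Icc.1 hl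
      have hm : 0 < Nat.choose (n - 1) (l - 1) := Nat.choose_pos (Nat.sub_le_sub_right hln 1)
      have hmR : (0 : ℝ) < Nat.choose (n - 1) (l - 1) := by exact_mod_cast hm
      have hwl0 := hw l hl
      rw [hKK, ← ENNReal.ofReal_natCast, ← ENNReal.ofReal_inv_of_pos hmR,
        ← ENNReal.ofReal_mul hwl0, ENNReal.ofReal_rpow_of_nonneg (by positivity) hs0.le,
        ← ENNReal.ofReal_pow (by positivity), ← ENNReal.ofReal_mul (by positivity),
        ← ENNReal.ofReal_mul (by positivity)]
      apply ENNReal.ofReal_le_ofReal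
      -- (MC1) enters only through `w l`, a single term of the tail sum.
      have h := hD n l _ hn hl1 hln hm (hchoose l) (w l) hwl0
        (hw1 ▸ Finset.single_le_sum hw hl) fun hl2 =>
          (Finset.single_le_sum (f := w) (fun j hj => hw j (Finset.mem_Icc.2
            ⟨hl1.trans (Finset.mem_Icc.1 hj).1, (Finset.mem_Icc.1 hj).2⟩))
            (Finset.mem_Icc.2 ⟨le_rfl, hln⟩)).trans (hwl l hl2)
      rw [pow_add, ← mul_assoc, ← mul_assoc]
      exact mul_le_mul_of_nonneg_right h (by positivity)
    refine (Finset.sum_le_sum hterm).trans (le_of_eq ?_)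
    rw [Finset.sum_const, Nat.card_Icc, Nat.add_sub_cancel, nsmul_eq_mul,
      ← ENNReal.ofReal_natCast, ← ENNReal.ofReal_mul hnR0.le, hE, mul_assoc]
  set u : ℝ := k * Real.log n with hu
  have hlogn : Real.log 2 ≤ Real.log n := Real.log_le_log two_pos hnR
  have hlogn_u : Real.log n ≤ u := le_mul_of_one_le_left (hlog2.le.trans hlogn) hkR
  have hk_u : (k : ℝ) ≤ u / Real.log 2 := by
    rw [le_div_iff₀ hlog2]
    exact mul_le_mul_of_nonneg_left hlogn (by positivity)
  have hlogR : Real.log R ≤ (2 + C₄) * u + k * (|Real.log c| + |Real.log C₃|) := by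
    have h1 : Real.log R = k * (Real.log n - Real.log c) + (-Real.log (w k) + Real.log C) := by
      rw [hR, Real.log_mul (by positivity) (by positivity), Real.log_mul (by positivity)
        (by positivity), Real.log_pow, Real.log_div (by positivity) (by positivity), Real.log_inv]
    have h2 : Real.log C₃ - C₄ * u ≤ Real.log (w k) := by
      refine le_trans (le_of_eq ?_) (Real.log_le_log (by positivity) hwk)
      rw [Real.log_mul (by positivity) (by positivity), Real.log_rpow hnR0, hu]
      ring
    have h3 : Real.log C ≤ u := by
      have h4 : (C : ℝ) ≤ (n : ℝ) ^ k := by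
        refine (Nat.cast_le.2 (hchoose k)).trans ?_
        push_cast
        exact pow_le_pow_right₀ (by linarith) (Nat.sub_le _ _)
      have := Real.log_le_log hCR h4
      rwa [Real.log_pow] at this
    have h5 : -(k * Real.log c) ≤ k * |Real.log c| := by
      rw [← mul_neg]
      exact mul_le_mul_of_nonneg_left (neg_le_abs _) (by positivity)
    have h6 : -Real.log C₃ ≤ k * |Real.log C₃| :=
      (neg_le_abs _).trans (le_mul_of_one_le_left (abs_nonneg _) hkR)
    rw [h1]
    linarith
  have hlogE : Real.log E ≤ u + k * (Real.log D + Real.log K) := by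
    rw [hE, Real.log_mul (by positivity) (by positivity), Real.log_mul (by positivity)
      (by positivity), Real.log_pow]
    linarith [le_mul_of_one_le_left hlogD hkR]
  have hu0 : 0 ≤ u := by linarith
  have hH : Real.log R + 1 / (2 * σ ^ 2) + (Real.log E + 1) / s ≤ (2 + C₄ + 1 / s) * u + k * J := by
    have h1 : (Real.log E + 1) / s ≤ (u + k * (Real.log D + Real.log K + 1)) / s := by
      refine div_le_div_of_nonneg_right ?_ hs0.le
      linarith
    have h2 : 1 / (2 * σ ^ 2) ≤ k * (1 / (2 * σ ^ 2)) := le_mul_of_one_le_left (by positivity) hkR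
    refine (add_le_add (add_le_add hlogR h2) h1).trans (le_of_eq ?_)
    rw [hJ]
    ring
  refine (lintegral_risk_le hσ hn0 hQhat hQ hQθ hR0 hQR ha0 hs0 hE1 hUm hUtop hUs hUE hH
    (by positivity)).trans (ENNReal.ofReal_le_ofReal ?_)
  rw [div_mul_eq_mul_div _ a u]
  refine div_le_div_of_nonneg_right ?_ ha0.le
  have h1 : J' ≤ k * J' := le_mul_of_one_le_left hJ'0.le hkR
  have h2 : k * (J + J') ≤ u / Real.log 2 * (J + J') := by gcongr
  calc (2 + C₄ + 1 / s) * u + k * J + 1 / σ ^ 2 * (2 * Real.exp (σ ^ 2 / 2)) + 1 / s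
      = (2 + C₄ + 1 / s) * u + k * J + J' := by rw [hJ']; ring
    _ ≤ (2 + C₄ + 1 / s) * u + u / Real.log 2 * (J + J') := by linarith
    _ = _ := by ring
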